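/- Let $m>0$, $1\le\alpha<2$, $T>0$ and let $\phi_-,\phi_+\in\mathbb R$ satisfy $0<|\phi_+-\phi_-|\le 2\pi$. Put $\bar V(z)=\frac{m}{\alpha|z|^{\alpha}}$ for $z\in\mathbb C\setminus\{0\}$, $\bar V(0)=+\infty$, and consider the Kepler-type problem $$\ddot x=\nabla\bar V(x)=-\frac{m\,x}{|x|^{\alpha+2}} .$$ Let $\mu=(\alpha+2)\big(\frac{m}{2\alpha}\big)^{1/2}$ and let $\bar x$ be the parabolic collision-ejection solution $$\bar x(t)=(\mu|t|)^{\frac{2}{\alpha+2}}e^{i\phi_+}\ (t\ge 0),\qquad \bar x(t)=(\mu|t|)^{\frac{2}{\alpha+2}}e^{i\phi_-}\ (t\le 0).$$ For $S>0$ let $\Gamma^*_S(\bar x;T)$ be the set of $x\in H^1([-S,S],\mathbb C\setminus\{0\})$ with $x(\pm S)=\bar x(\pm T)$ for which there is a continuous $\theta:[-S,S]\to\mathbb R$ with $x=|x|e^{i\theta}$, $\theta(-S)=\phi_-$ and $\theta(S)=\phi_+$. Let $\Gamma_S(\bar x;T)$ be the set of all limits in $H^1([-S,S],\mathbb C)$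 of weakly convergent sequences in $\Gamma^*_S(\bar x;T)$, and write $\Gamma^*_T(\bar x)=\Gamma^*_T(\bar x;T)$, $\Gamma_T(\bar x)=\Gamma_T(\bar x;T)$. Define, with values in $[0,\infty]$, $$\bar M(x)=\int_{-T}^{T}\tfrac12|\dot x|^2\,dt\int_{-T}^{T}\bar V(x)\,dt,\qquad \bar A_S(x)=\int_{-S}^{S}\Big(\tfrac12|\dot x|^2+\bar V(x)\Big)dt,$$ $$\bar m_T=\inf\{\bar M(x):x\in\Gamma_T(\bar x)\},\qquad \bar c(\bar x;T)=\inf\{\bar A_S(x):S>0,\ x\in\Gamma_S(\bar x;T)\}.$$ (a) There is $y\in\Gamma_T(\bar x)$ with $\bar M(y)=\bar m_T\in(0,\infty)$ such that, if $\alpha\in(1,2)$, or if $\alpha=1$ and $|\phi_+-\phi_-|<2\pi$, then $y\in\Gamma^*_T(\bar x)$ (so $y$ has no collision with the origin), $y$ is after a linear change of time a classical zero-energy solution of the Kepler-type problem, namely, with $\omega>0$ given by $\omega^2=\int_{-T}^{T}\bar V(y)\,dt\big/\int_{-T}^{T}\frac12|\dot y|^2\,dt$, the curve $x(t)=y(\omega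 t)$, $t\in[-T/\omega,T/\omega]$, satisfies $\ddot x=\nabla\bar V(x)$ and $\frac12|\dot x|^2-\bar V(x)=0$, and $\bar M(y)<\bar M(\bar x)$. (b) There are $S>0$ and $\eta\in\Gamma_S(\bar x;T)$ with $\bar A_S(\eta)=\bar c(\bar x;T)<\infty$ such that, if $\alpha\in(1,2)$, or if $\alpha=1$ and $|\phi_+-\phi_-|<2\pi$, then $\eta\in\Gamma^*_S(\bar x;T)$, $\eta$ is a classical solution on $[-S,S]$ of the Kepler-type problem with zero energy, and $\bar A_S(\eta)<\bar A_T(\bar x)$. -/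

import Mathlib

open MeasureTheory Set Filter Topology
open scoped ENNReal

noncomputable section

namespace Kepler

/-- `x ∈ H¹([a,b], ℂ)`: the (continuous representative of the) curve `x` is absolutely continuous
on `[a,b]` and its almost everywhere defined derivative is square integrable. Only the values of
`x` on `[a,b]` matter. -/
def MemH1 (a b : ℝ) (x : ℝ → ℂ) : Prop :=
  AbsolutelyContinuousOnInterval x a b ∧ MemLp (deriv x) 2 (volume.restrict (Icc a b))

/-- The continuous linear functional on `H¹([a,b], ℂ)` (as a real Hilbert space) given by a pair
`g₀, g₁` of square integrable functions. Every continuous linear functional is of this form. -/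
def h1Functional (a b : ℝ) (g₀ g₁ x : ℝ → ℂ) : ℝ :=
  ∫ t in Icc a b, (inner ℝ (g₀ t) (x t) + inner ℝ (g₁ t) (deriv x t))

/-- Weak convergence in `H¹([a,b], ℂ)` of the sequence `xs` to `x`. -/
def WeakH1Tendsto (a b : ℝ) (xs : ℕ → ℝ → ℂ) (x : ℝ → ℂ) : Prop :=
  ∀ g₀ g₁ : ℝ → ℂ, MemLp g₀ 2 (volume.restrict (Icc a b)) →
    MemLp g₁ 2 (volume.restrict (Icc a b)) →
    Tendsto (fun n => h1Functional a b g₀ g₁ (xs n)) atTop (𝓝 (h1Functional a b g₀ g₁ x))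

/-- The weak (sequential) closure in `H¹([a,b], ℂ)` of a set of curves. -/
def weakH1Closure (a b : ℝ) (C : Set (ℝ → ℂ)) : Set (ℝ → ℂ) :=
  {x | MemH1 a b x ∧ ∃ xs : ℕ → ℝ → ℂ, (∀ n, xs n ∈ C) ∧ WeakH1Tendsto a b xs x}

/-- The negative potential `m / (α |z|^α)`, with value `∞` at the origin (for `m, α > 0`). -/
def potential (m α : ℝ) (z : ℂ) : ℝ≥0∞ :=
  ENNReal.ofReal m / (ENNReal.ofReal α * ‖z‖ₑ ^ α)

/-- `∫_a^b ½ |ẋ|² dt`. -/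
def kineticIntegral (a b : ℝ) (x : ℝ → ℂ) : ℝ≥0∞ :=
  ∫⁻ t in Icc a b, 2⁻¹ * ‖deriv x t‖ₑ ^ 2

/-- `∫_a^b V(x) dt`. -/
def potentialIntegral (m α a b : ℝ) (x : ℝ → ℂ) : ℝ≥0∞ :=
  ∫⁻ t in Icc a b, potential m α (x t)

/-- The action `∫_{-S}^{S} (½ |ẋ|² + V(x)) dt`. -/
def action (m α S : ℝ) (x : ℝ → ℂ) : ℝ≥0∞ :=
  ∫⁻ t in Icc (-S) S, (2⁻¹ * ‖deriv x t‖ₑ ^ 2 + potential m α (x t))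

/-- The zero-energy Maupertuis functional `∫_{-T}^{T} ½ |ẋ|² dt · ∫_{-T}^{T} V(x) dt`. -/
def maupertuis (m α T : ℝ) (x : ℝ → ℂ) : ℝ≥0∞ :=
  kineticIntegral (-T) T x * potentialIntegral m α (-T) T x

/-- The constant `μ = (α + 2) (m / (2α))^{1/2}`. -/
def mu (m α : ℝ) : ℝ := (α + 2) * Real.sqrt (m / (2 * α))

/-- The parabolic collision-ejection solution with angles `φm = φ₋` and `φp = φ₊`. -/
def xbar (m α φm φp : ℝ) (t : ℝ) : ℂ :=
  (((mu m α * |t|) ^ (2 / (α + 2)) : ℝ) : ℂ) *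
    Complex.exp (((if 0 ≤ t then φp else φm : ℝ) : ℂ) * Complex.I)

/-- The class `Γ*_S(x̄; T)`: collision-free `H¹` curves on `[-S, S]` from `x̄(-T)` to `x̄(T)` whose
argument, followed continuously along the curve, goes from `φ₋` to `φ₊`. -/
def GammaStar (m α φm φp T S : ℝ) : Set (ℝ → ℂ) :=
  {x | MemH1 (-S) S x ∧ (∀ t ∈ Icc (-S) S, x t ≠ 0) ∧
    x (-S) = xbar m α φm φp (-T) ∧ x S = xbar m α φm φp T ∧
    ∃ θ : ℝ → ℝ, ContinuousOn θ (Icc (-S) S) ∧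
      (∀ t ∈ Icc (-S) S, x t = (‖x t‖ : ℂ) * Complex.exp ((θ t : ℂ) * Complex.I)) ∧
      θ (-S) = φm ∧ θ S = φp}

/-- The class `Γ_S(x̄; T)`; for `S = T` this is `Γ_T(x̄)`. -/
def Gamma (m α φm φp T S : ℝ) : Set (ℝ → ℂ) :=
  weakH1Closure (-S) S (GammaStar m α φm φp T S)

/-- The infimum of the Maupertuis functional on `Γ_T(x̄)`. -/
def maupertuisInf (m α φm φp T : ℝ) : ℝ≥0∞ :=
  ⨅ x ∈ Gamma m α φm φp T T, maupertuis m α T x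

/-- The free-time infimum of the action, over all `S > 0` and all curves in `Γ_S(x̄; T)`. -/
def freeTimeActionInf (m α φm φp T : ℝ) : ℝ≥0∞ :=
  ⨅ S ∈ Ioi (0 : ℝ), ⨅ x ∈ Gamma m α φm φp T S, action m α S x

/-- `x` is, on `[a,b]`, a classical collision-free solution of `ẍ = -m x / |x|^{α+2}` with energy
`½ |ẋ|² - m / (α |x|^α) = 0` (one-sided derivatives at the endpoints). -/
def IsZeroEnergySolution (m α a b : ℝ) (x : ℝ → ℂ) : Prop :=
  ∃ v : ℝ → ℂ, ∀ t ∈ Icc a b, x t ≠ 0 ∧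
    HasDerivWithinAt x (v t) (Icc a b) t ∧
    HasDerivWithinAt v (-(m / ‖x t‖ ^ (α + 2)) • x t) (Icc a b) t ∧
    ‖v t‖ ^ 2 / 2 - m / (α * ‖x t‖ ^ α) = 0

end Kepler

end

/-! Put β = 1 - α/2. In the coordinate w = z^β, continued along the curve, β |z|^(-α/2) |dz| = |dw|:
the zero-energy Jacobi metric of the potential is flat up to a constant factor. By Cauchy–Schwarz
the Maupertuis functional of any curve is at least a constant times the square of its flat length,
and by AM–GM the action is at least twice the square root of the Maupertuis functional, for every
time interval.

The endpoints have a common modulus R and their images subtend the angle 2γ, where γ = β(φ₊ - φ₋)/2.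
A collision-free curve of the class therefore has flat length at least the chord 2 R^β |sin γ|. A
curve that hits the origin has length at least 2 R^β, which is no smaller. So one explicit constant
B (`halfAction` at |sin γ|) satisfies M ≥ B² and A ≥ 2B on the whole weak closure
(`halfAction_sq_le_maupertuis`, `two_mul_halfAction_le_action`). The passage to the closure rests on
`mem_GammaStar_of_mem_Gamma`: weak H¹ convergence is uniform, so a collision-free limit keeps the
prescribed argument.

Existence is by exhibition, not by compactness. Since 1 ≤ α, one has |γ| ≤ π/2. If |γ| < π/2, the
straight chord misses the origin. Run at zero energy, it solves the equation and attains both bounds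
(`exists_zeroEnergy_minimizer`), while x̄ consists of two flat radii and its values are those with
|sin γ| replaced by 1, hence strictly larger. If |γ| = π/2, which forces α = 1 and total angle 2π,
the chord is a diameter and x̄ itself attains the bounds. It belongs to the closure by
`xbar_mem_Gamma`. -/

noncomputable section

/-! ### Absolutely continuous curves in ℂ and their logarithms. -/

namespace AbsolutelyContinuousOnInterval

theorem lipschitzOnWith_comp {X Y : Type*} [PseudoMetricSpace X] [PseudoMetricSpace Y]
    {f : ℝ → X} {a b : ℝ} {φ : X → Y} {K : NNReal}
    (hf : AbsolutelyContinuousOnInterval f a b) (hφ : LipschitzOnWith K φ (f '' uIcc a b)) :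
    AbsolutelyContinuousOnInterval (fun t => φ (f t)) a b := by
  have h0 := Tendsto.const_mul (K : ℝ) hf
  rw [mul_zero] at h0
  refine squeeze_zero' (Eventually.of_forall fun E => Finset.sum_nonneg fun i _ => dist_nonneg)
    ?_ h0
  refine eventually_inf_principal.2 (Eventually.of_forall fun E hE => ?_)
  rw [Finset.mul_sum]
  refine Finset.sum_le_sum fun i hi => ?_
  exact hφ.dist_le_mul _ (mem_image_of_mem f (hE.1 i hi).1) _ (mem_image_of_mem f (hE.1 i hi).2)

theorem lipschitzWith_comp {X Y : Type*} [PseudoMetricSpace X] [PseudoMetricSpace Y]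
    {f : ℝ → X} {a b : ℝ} {φ : X → Y} {K : NNReal}
    (hf : AbsolutelyContinuousOnInterval f a b) (hφ : LipschitzWith K φ) :
    AbsolutelyContinuousOnInterval (fun t => φ (f t)) a b :=
  hf.lipschitzOnWith_comp hφ.lipschitzOnWith

theorem contDiff_comp {E F : Type*} [NormedAddCommGroup E] [NormedSpace ℝ E] [ProperSpace E]
    [NormedAddCommGroup F] [NormedSpace ℝ F]
    {f : ℝ → E} {a b : ℝ} {φ : E → F}
    (hf : AbsolutelyContinuousOnInterval f a b) (hφ : ContDiff ℝ 1 φ) :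
    AbsolutelyContinuousOnInterval (fun t => φ (f t)) a b := by
  obtain ⟨C, hC⟩ := hf.exists_bound
  obtain ⟨K, hK⟩ := (hφ.contDiffOn (s := Metric.closedBall 0 C)).exists_lipschitzOnWith
    (by decide) (convex_closedBall _ _) (isCompact_closedBall _ _)
  refine hf.lipschitzOnWith_comp (hK.mono ?_)
  rintro _ ⟨t, ht, rfl⟩
  simpa using hC t ht

variable {f : ℝ → ℂ} {a b : ℝ}

theorem complex_re (hf : AbsolutelyContinuousOnInterval f a b) :
    AbsolutelyContinuousOnInterval (fun t => (f t).re) a b :=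
  hf.lipschitzWith_comp Complex.reCLM.lipschitz

theorem complex_im (hf : AbsolutelyContinuousOnInterval f a b) :
    AbsolutelyContinuousOnInterval (fun t => (f t).im) a b :=
  hf.lipschitzWith_comp Complex.imCLM.lipschitz

theorem of_re_im (hr : AbsolutelyContinuousOnInterval (fun t => (f t).re) a b)
    (hi : AbsolutelyContinuousOnInterval (fun t => (f t).im) a b) :
    AbsolutelyContinuousOnInterval f a b := by
  have h1 := hr.lipschitzWith_comp Complex.ofRealCLM.lipschitz
  have h2 := (hi.lipschitzWith_comp Complex.ofRealCLM.lipschitz).const_smul Complex.I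
  have h : f = (fun t => Complex.ofRealCLM (f t).re) +
      fun t => Complex.I • Complex.ofRealCLM (f t).im := by
    funext t
    simp [mul_comm Complex.I]
  rw [h]
  exact h1.add h2

theorem ae_differentiableAt_complex (hf : AbsolutelyContinuousOnInterval f a b) :
    ∀ᵐ t : ℝ, t ∈ uIcc a b → DifferentiableAt ℝ f t :=
  hf.boundedVariationOn.ae_differentiableAt_of_mem_uIcc

theorem ae_deriv_re_im (hf : AbsolutelyContinuousOnInterval f a b) :
    ∀ᵐ t : ℝ, t ∈ uIcc a b → (deriv f t).re = deriv (fun s => (f s).re) t ∧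
      (deriv f t).im = deriv (fun s => (f s).im) t := by
  filter_upwards [hf.ae_differentiableAt_complex] with t ht hmem
  have h := (ht hmem).hasDerivAt
  constructor
  · exact (Complex.reCLM.hasFDerivAt.comp_hasDerivAt t h).deriv.symm
  · exact (Complex.imCLM.hasFDerivAt.comp_hasDerivAt t h).deriv.symm

theorem intervalIntegrable_deriv_complex (hf : AbsolutelyContinuousOnInterval f a b) :
    IntervalIntegrable (deriv f) volume a b := by
  have h1 := hf.complex_re.intervalIntegrable_deriv
  have h2 := hf.complex_im.intervalIntegrable_deriv
  have h3 : IntervalIntegrable (fun t => ((deriv (fun s => (f s).re) t : ℝ) : ℂ) +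
      ((deriv (fun s => (f s).im) t : ℝ) : ℂ) * Complex.I) volume a b :=
    IntervalIntegrable.add ⟨h1.1.ofReal, h1.2.ofReal⟩
      (IntervalIntegrable.mul_const ⟨h2.1.ofReal, h2.2.ofReal⟩ Complex.I)
  refine h3.congr_ae ?_
  rw [EventuallyEq, ae_restrict_iff' measurableSet_uIoc]
  filter_upwards [hf.ae_deriv_re_im] with t ht hmem
  obtain ⟨h4, h5⟩ := ht (uIoc_subset_uIcc hmem)
  rw [← h4, ← h5, Complex.re_add_im]

end AbsolutelyContinuousOnInterval

/-- Real and imaginary parts commute with the integral, which reduces this to the real-valued case.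
-/
theorem IntervalIntegrable.absolutelyContinuousOnInterval_complex {f : ℝ → ℂ} {a b c : ℝ}
    (h : IntervalIntegrable f volume a b) (hc : c ∈ uIcc a b) :
    AbsolutelyContinuousOnInterval (fun t => ∫ s in c..t, f s) a b := by
  have key : ∀ L : ℂ →L[ℝ] ℝ,
      AbsolutelyContinuousOnInterval (fun t => L (∫ s in c..t, f s)) a b := by
    intro L
    have hL : IntervalIntegrable (fun t => L (f t)) volume a b :=
      ⟨L.integrable_comp h.1, L.integrable_comp h.2⟩
    have h1 := hL.absolutelyContinuousOnInterval_intervalIntegral hc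
    have h2 : ∀ t ∈ uIcc a b, L (∫ s in c..t, f s) = ∫ s in c..t, L (f s) := fun t ht =>
      (L.intervalIntegral_comp_comm (h.mono_set (uIcc_subset_uIcc hc ht))).symm
    refine h1.congr' (eventually_inf_principal.2 (Eventually.of_forall fun E hE => ?_))
    refine Finset.sum_congr rfl fun i hi => ?_
    simp only [h2 _ (hE.1 i hi).1, h2 _ (hE.1 i hi).2]
  exact .of_re_im (key Complex.reCLM) (key Complex.imCLM)

namespace AbsolutelyContinuousOnInterval

variable {f : ℝ → ℂ} {a b : ℝ}

theorem congr' {X : Type*} [PseudoMetricSpace X] {f g : ℝ → X}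
    (hf : AbsolutelyContinuousOnInterval f a b)
    (hfg : ∀ t ∈ uIcc a b, f t = g t) : AbsolutelyContinuousOnInterval g a b := by
  refine Tendsto.congr' (eventually_inf_principal.2 (Eventually.of_forall fun E hE => ?_)) hf
  refine Finset.sum_congr rfl fun i hi => ?_
  simp only [hfg _ (hE.1 i hi).1, hfg _ (hE.1 i hi).2]

theorem integral_deriv_eq_sub_complex (hf : AbsolutelyContinuousOnInterval f a b) :
    ∫ t in a..b, deriv f t = f b - f a := by
  have hi := hf.intervalIntegrable_deriv_complex
  have hac := hi.absolutelyContinuousOnInterval_complex (c := a) (by simp)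
  have g_ac := hf.fun_sub hac
  have g0 : ∀ᵐ t, t ∈ uIcc a b → HasDerivAt (fun t => f t - ∫ s in a..t, deriv f s) 0 t := by
    filter_upwards [hf.ae_differentiableAt_complex, hi.ae_hasDerivAt_integral] with t h1 h2 h3
    convert! (h1 h3).hasDerivAt.sub (h2 h3 a (by simp))
    abel
  obtain ⟨C, hC⟩ := g_ac.const_of_ae_hasDerivAt_zero g0
  have h1 := hC a (by simp)
  have h2 := hC b (by simp)
  simp only [intervalIntegral.integral_same, sub_zero] at h1 h2
  rw [← h1] at h2
  rw [← h2]
  ring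

theorem enorm_sub_le_lintegral_deriv (hab : a ≤ b) (hf : AbsolutelyContinuousOnInterval f a b) :
    ‖f b - f a‖ₑ ≤ ∫⁻ t in Icc a b, ‖deriv f t‖ₑ := by
  rw [← hf.integral_deriv_eq_sub_complex, intervalIntegral.integral_of_le hab]
  refine (enorm_integral_le_lintegral_enorm _).trans ?_
  exact lintegral_mono_set Ioc_subset_Icc_self

/-- A nonvanishing absolutely continuous curve has an absolutely continuous logarithm. -/
theorem exists_log_lift (hf : AbsolutelyContinuousOnInterval f a b)
    (h0 : ∀ t ∈ uIcc a b, f t ≠ 0) {ℓ₀ : ℂ} (hℓ₀ : Complex.exp ℓ₀ = f a) :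
    ∃ ℓ : ℝ → ℂ, AbsolutelyContinuousOnInterval ℓ a b ∧ ℓ a = ℓ₀ ∧
      (∀ t ∈ uIcc a b, Complex.exp (ℓ t) = f t) ∧
      ∀ᵐ t : ℝ, t ∈ uIcc a b → HasDerivAt ℓ (deriv f t / f t) t := by
  have hq : IntervalIntegrable (fun t => deriv f t / f t) volume a b := by
    simp only [div_eq_mul_inv]
    exact hf.intervalIntegrable_deriv_complex.mul_continuousOn (hf.continuousOn.inv₀ h0)
  have hac := hq.absolutelyContinuousOnInterval_complex (c := a) (by simp)
  -- The logarithm is built as a primitive of f'/f. It exponentiates to f because f · exp(-ℓ) is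
  -- absolutely continuous with derivative zero almost everywhere, hence constant.
  set ℓ : ℝ → ℂ := fun t => ℓ₀ + ∫ s in a..t, deriv f s / f s with hℓ
  have hℓac : AbsolutelyContinuousOnInterval ℓ a b :=
    hac.lipschitzWith_comp (φ := fun z => ℓ₀ + z) (LipschitzWith.of_dist_le_mul (K := 1) (by simp))
  have hd : ∀ᵐ t : ℝ, t ∈ uIcc a b → HasDerivAt ℓ (deriv f t / f t) t := by
    filter_upwards [hq.ae_hasDerivAt_integral] with t h1 h2
    exact (h1 h2 a (by simp)).const_add ℓ₀
  refine ⟨ℓ, hℓac, by simp [hℓ], ?_, hd⟩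
  have hexp : AbsolutelyContinuousOnInterval (fun t => Complex.exp (-ℓ t)) a b :=
    hℓac.contDiff_comp (φ := fun z => Complex.exp (-z)) (by fun_prop)
  have hprod := hf.smul hexp
  have hz : ∀ᵐ t, t ∈ uIcc a b → HasDerivAt (f • fun t => Complex.exp (-ℓ t)) 0 t := by
    filter_upwards [hf.ae_differentiableAt_complex, hd] with t h1 h2 h3
    have h4 := (h1 h3).hasDerivAt.mul (h2 h3).neg.cexp
    convert! h4 using 1
    field_simp [h0 t h3]
    ring
  obtain ⟨C, hC⟩ := hprod.const_of_ae_hasDerivAt_zero hz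
  have hCa := hC a (by simp)
  have hℓa : ℓ a = ℓ₀ := by simp [hℓ]
  simp only [Pi.smul_apply', smul_eq_mul, hℓa, ← hℓ₀, Complex.exp_neg,
    mul_inv_cancel₀ (Complex.exp_ne_zero ℓ₀)] at hCa
  intro t ht
  have h := hC t ht
  simp only [Pi.smul_apply', smul_eq_mul, Complex.exp_neg, ← hCa] at h
  field_simp [Complex.exp_ne_zero] at h
  exact h.symm

end AbsolutelyContinuousOnInterval

/-- Two continuous arguments of the same curve that agree at the initial time agree. -/
theorem eqOn_of_exp_mul_I_eq {a b : ℝ} {f g : ℝ → ℝ} (hf : ContinuousOn f (Icc a b))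
    (hg : ContinuousOn g (Icc a b)) (h0 : f a = g a)
    (h : ∀ t ∈ Icc a b, Complex.exp (f t * Complex.I) = Complex.exp (g t * Complex.I)) :
    EqOn f g (Icc a b) := by
  intro t ht
  have hc : ContinuousOn (fun s => (f s - g s) / (2 * Real.pi)) (Icc a b) :=
    (hf.sub hg).div_const _
  have hint : ∀ s ∈ Icc a b, ∃ n : ℤ, (f s - g s) / (2 * Real.pi) = n := by
    intro s hs
    obtain ⟨n, hn⟩ := Complex.exp_eq_exp_iff_exists_int.1 (h s hs)
    refine ⟨n, ?_⟩
    have h1 : (f s : ℂ) = g s + n * (2 * Real.pi) := by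
      apply mul_right_cancel₀ Complex.I_ne_zero
      rw [hn]; ring
    have h2 : f s = g s + n * (2 * Real.pi) := by exact_mod_cast h1
    rw [h2]
    field_simp [Real.pi_ne_zero]
    ring
  have ha : a ∈ Icc a b := ⟨le_rfl, ht.1.trans ht.2⟩
  have hconst := isPreconnected_Icc.constant_of_mapsTo (S := Icc a b)
    (T := range ((↑) : ℤ → ℝ))
    Int.isClosedEmbedding_coe_real.isInducing.isDiscrete_range hc (fun s hs => by
      obtain ⟨n, hn⟩ := hint s hs
      exact ⟨n, hn.symm⟩) ht ha
  simp only [h0, sub_self, zero_div, div_eq_zero_iff] at hconst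
  rcases hconst with h1 | h1
  · linarith
  · exact absurd h1 (by positivity)

/-! ### Weak H¹ convergence, and persistence of the argument in collision-free limits. -/

namespace Kepler

variable {a b : ℝ} {x : ℝ → ℂ}

theorem MemH1.continuousOn (hab : a ≤ b) (hx : MemH1 a b x) : ContinuousOn x (Icc a b) := by
  simpa [uIcc_of_le hab] using hx.1.continuousOn

theorem MemH1.memLp (hab : a ≤ b) (hx : MemH1 a b x) :
    MemLp x 2 (volume.restrict (Icc a b)) := by
  obtain ⟨C, hC⟩ := isCompact_Icc.exists_bound_of_continuousOn (hx.continuousOn hab)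
  refine MemLp.of_bound ((hx.continuousOn hab).aestronglyMeasurable measurableSet_Icc) C ?_
  exact (ae_restrict_iff' measurableSet_Icc).2 (Eventually.of_forall hC)

/-- The kernel of the functional `x ↦ (b - a) x(t)` on `H¹([a,b])`. -/
def evalKernel (a b t s : ℝ) : ℝ := if s ≤ t then s - a else s - b

/-- Integrates the product rule for (s - c) x(s). With c = a to the left of t and c = b to its
right, the boundary terms at a and b vanish and only x(t) survives. -/
theorem integral_deriv_sub_smul {c : ℝ} (hx : AbsolutelyContinuousOnInterval x a b) :
    IntervalIntegrable (fun s => x s + (s - c) • deriv x s) volume a b ∧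
    ∫ s in a..b, (x s + (s - c) • deriv x s) = (b - c) • x b - (a - c) • x a := by
  have hl : AbsolutelyContinuousOnInterval (fun s : ℝ => s - c) a b :=
    ContDiffOn.absolutelyContinuousOnInterval (by fun_prop)
  have hp := hl.fun_smul hx
  have hd : ∀ᵐ s : ℝ, s ∈ uIoc a b →
      deriv (fun s => (s - c) • x s) s = x s + (s - c) • deriv x s := by
    filter_upwards [hx.ae_differentiableAt_complex] with s hs hmem
    have h1 := ((hasDerivAt_id s).sub_const c).smul (hs (uIoc_subset_uIcc hmem)).hasDerivAt
    have h2 := h1.deriv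
    simp only [id, one_smul] at h2
    rw [add_comm, ← h2]
    rfl
  constructor
  · refine hp.intervalIntegrable_deriv_complex.congr_ae ?_
    exact (ae_restrict_iff' measurableSet_uIoc).2 hd
  · rw [← hp.integral_deriv_eq_sub_complex]
    exact (intervalIntegral.integral_congr_ae hd).symm

theorem evalKernel_integral {t : ℝ} (ht : t ∈ Icc a b)
    (hx : AbsolutelyContinuousOnInterval x a b) :
    Integrable (fun s => x s + evalKernel a b t s • deriv x s) (volume.restrict (Icc a b)) ∧
    ∫ s in Icc a b, (x s + evalKernel a b t s • deriv x s) = (b - a) • x t := by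
  have hab := ht.1.trans ht.2
  have htu : t ∈ uIcc a b := by rwa [uIcc_of_le hab]
  have h1 := integral_deriv_sub_smul (c := a)
    (hx.mono (uIcc_subset_uIcc left_mem_uIcc htu))
  have h2 := integral_deriv_sub_smul (c := b)
    (hx.mono (uIcc_subset_uIcc htu right_mem_uIcc))
  have e1 : ∀ s ∈ uIoc a t, x s + (s - a) • deriv x s =
      x s + evalKernel a b t s • deriv x s := by
    intro s hs
    rw [uIoc_of_le ht.1] at hs
    simp [evalKernel, hs.2]
  have e2 : ∀ s ∈ uIoc t b, x s + (s - b) • deriv x s =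
      x s + evalKernel a b t s • deriv x s := by
    intro s hs
    rw [uIoc_of_le ht.2] at hs
    simp [evalKernel, not_le.2 hs.1]
  have i1 : IntervalIntegrable (fun s => x s + evalKernel a b t s • deriv x s) volume a t :=
    h1.1.congr e1
  have i2 : IntervalIntegrable (fun s => x s + evalKernel a b t s • deriv x s) volume t b :=
    h2.1.congr e2
  constructor
  · exact (intervalIntegrable_iff_integrableOn_Icc_of_le hab).1 (i1.trans i2)
  · rw [integral_Icc_eq_integral_Ioc, ← intervalIntegral.integral_of_le hab,
      ← intervalIntegral.integral_add_adjacent_intervals i1 i2,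
      ← intervalIntegral.integral_congr_ae (Eventually.of_forall e1),
      ← intervalIntegral.integral_congr_ae (Eventually.of_forall e2),
      h1.2, h2.2]
    module

theorem memLp_evalKernel_smul (t : ℝ) (v : ℂ) :
    MemLp (fun s => evalKernel a b t s • v) 2 (volume.restrict (Icc a b)) := by
  refine MemLp.of_bound (C := (b - a) * ‖v‖) ?_ ?_
  · refine Measurable.aestronglyMeasurable ?_
    refine Measurable.smul_const ?_ v
    exact Measurable.ite measurableSet_Iic (by fun_prop) (by fun_prop)
  · refine (ae_restrict_iff' measurableSet_Icc).2 (Eventually.of_forall fun s hs => ?_)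
    rw [norm_smul]
    refine mul_le_mul_of_nonneg_right ?_ (norm_nonneg v)
    rw [Real.norm_eq_abs, evalKernel]
    split_ifs <;> rw [abs_le] <;> constructor <;> linarith [hs.1, hs.2]

theorem h1Functional_evalKernel {t : ℝ} (ht : t ∈ Icc a b) (v : ℂ)
    (hx : AbsolutelyContinuousOnInterval x a b) :
    h1Functional a b (fun _ => v) (fun s => evalKernel a b t s • v) x =
      (b - a) * inner ℝ v (x t) := by
  obtain ⟨h1, h2⟩ := evalKernel_integral ht hx
  rw [h1Functional, ← real_inner_smul_right, ← h2, ← integral_inner h1]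
  refine integral_congr_ae (Eventually.of_forall fun s => ?_)
  simp only [inner_add_right, real_inner_smul_left, real_inner_smul_right]

/-- Point evaluation is one of the functionals tested by weak convergence, represented by the pair
(v, `evalKernel` · v). -/
theorem WeakH1Tendsto.tendsto_apply {xs : ℕ → ℝ → ℂ} (hab : a < b)
    (hxs : ∀ n, MemH1 a b (xs n)) (hx : MemH1 a b x) (h : WeakH1Tendsto a b xs x)
    {t : ℝ} (ht : t ∈ Icc a b) : Tendsto (fun n => xs n t) atTop (𝓝 (x t)) := by
  have key : ∀ v : ℂ, Tendsto (fun n => inner ℝ v (xs n t)) atTop (𝓝 (inner ℝ v (x t))) := by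
    intro v
    have h1 := h _ _ (memLp_const v) (memLp_evalKernel_smul t v)
    simp only [h1Functional_evalKernel ht v hx.1,
      fun n => h1Functional_evalKernel ht v (hxs n).1] at h1
    have h2 := h1.const_mul (b - a)⁻¹
    simpa only [inv_mul_cancel_left₀ (sub_ne_zero.2 hab.ne')] using h2
  have hre : Tendsto (fun n => (xs n t).re) atTop (𝓝 (x t).re) := by
    simpa [Complex.inner] using key 1
  have him : Tendsto (fun n => (xs n t).im) atTop (𝓝 (x t).im) := by
    simpa [Complex.inner] using key Complex.I
  have h3 : Tendsto (fun n => (((xs n t).re : ℝ) : ℂ) + (((xs n t).im : ℝ) : ℂ) * Complex.I)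
      atTop (𝓝 (((x t).re : ℂ) + ((x t).im : ℂ) * Complex.I)) :=
    ((Complex.continuous_ofReal.tendsto _).comp hre).add
      (((Complex.continuous_ofReal.tendsto _).comp him).mul_const _)
  simpa only [Complex.re_add_im] using h3

/-- Uniform boundedness principle, applied to pairing with the derivatives on L². Only test pairs
with g₀ = 0 are needed. -/
theorem WeakH1Tendsto.exists_eLpNorm_deriv_le {xs : ℕ → ℝ → ℂ}
    (hxs : ∀ n, MemH1 a b (xs n)) (h : WeakH1Tendsto a b xs x) :
    ∃ C : ℝ, 0 ≤ C ∧ ∀ n, eLpNorm (deriv (xs n)) 2 (volume.restrict (Icc a b)) ≤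
      ENNReal.ofReal C := by
  set ν := volume.restrict (Icc a b)
  let L : ℕ → (Lp ℂ 2 ν →L[ℝ] ℝ) := fun n => innerSL ℝ ((hxs n).2.toLp (deriv (xs n)))
  have hL : ∀ g : Lp ℂ 2 ν, ∃ C, ∀ n, ‖L n g‖ ≤ C := by
    intro g
    have h1 := h (fun _ => 0) g (memLp_const 0) (Lp.memLp g)
    have h2 : ∀ n, L n g = h1Functional a b (fun _ => 0) g (xs n) := by
      intro n
      change inner ℝ ((hxs n).2.toLp (deriv (xs n))) g = _
      rw [MeasureTheory.L2.inner_def, h1Functional]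
      refine integral_congr_ae ?_
      filter_upwards [(hxs n).2.coeFn_toLp] with s hs
      rw [hs, inner_zero_left, zero_add, real_inner_comm]
    obtain ⟨C, hC⟩ := h1.norm.bddAbove_range
    exact ⟨C, fun n => by rw [h2]; exact hC (mem_range_self n)⟩
  obtain ⟨C, hC⟩ := banach_steinhaus hL
  refine ⟨C, (norm_nonneg _).trans (hC 0), fun n => ?_⟩
  have h3 := hC n
  simp only [L, innerSL_apply_norm, Lp.norm_toLp] at h3
  exact (ENNReal.le_ofReal_iff_toReal_le (hxs n).2.2.ne ((norm_nonneg _).trans (hC 0))).2 h3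

/-- Cauchy–Schwarz on [s, t]: an L² bound on the derivative gives a Hölder-1/2 modulus, hence
equicontinuity of a weakly convergent sequence. -/
theorem dist_le_mul_sqrt_of_eLpNorm_deriv_le {C : ℝ} (hC : 0 ≤ C)
    (hx : MemH1 a b x)
    (h : eLpNorm (deriv x) 2 (volume.restrict (Icc a b)) ≤ ENNReal.ofReal C)
    {s t : ℝ} (hs : s ∈ Icc a b) (ht : t ∈ Icc a b) :
    dist (x s) (x t) ≤ C * Real.sqrt (dist s t) := by
  wlog hst : s ≤ t generalizing s t
  · rw [dist_comm, dist_comm s t]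
    exact this ht hs (not_le.1 hst).le
  have hsub : Icc s t ⊆ Icc a b := Icc_subset_Icc hs.1 ht.2
  have hsub' : uIcc s t ⊆ uIcc a b := by
    rw [uIcc_of_le hst, uIcc_of_le (hs.1.trans hs.2)]
    exact hsub
  have h1 := (hx.1.mono hsub').enorm_sub_le_lintegral_deriv hst
  have hmeas : AEStronglyMeasurable (deriv x) (volume.restrict (Icc s t)) :=
    (hx.2.mono_measure (Measure.restrict_mono hsub le_rfl)).1
  have h2 := eLpNorm_le_eLpNorm_mul_rpow_measure_univ (p := 1) (q := 2) (by norm_num) hmeas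
  rw [eLpNorm_one_eq_lintegral_enorm] at h2
  have h3 : eLpNorm (deriv x) 2 (volume.restrict (Icc s t)) ≤ ENNReal.ofReal C :=
    (eLpNorm_mono_measure _ (Measure.restrict_mono hsub le_rfl)).trans h
  have h4 : ‖x t - x s‖ₑ ≤ ENNReal.ofReal (C * Real.sqrt (t - s)) := by
    refine h1.trans (h2.trans ?_)
    rw [ENNReal.ofReal_mul hC]
    refine mul_le_mul' h3 ?_
    rw [Measure.restrict_apply_univ, Real.volume_Icc, Real.sqrt_eq_rpow,
      ENNReal.ofReal_rpow_of_nonneg (sub_nonneg.2 hst) (by norm_num)]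
    norm_num
  rw [← ofReal_norm, ENNReal.ofReal_le_ofReal_iff (by positivity)] at h4
  rw [dist_comm, dist_eq_norm, dist_comm, Real.dist_eq, abs_of_nonneg (sub_nonneg.2 hst)]
  exact h4

theorem WeakH1Tendsto.tendstoUniformlyOn {xs : ℕ → ℝ → ℂ} (hab : a < b)
    (hxs : ∀ n, MemH1 a b (xs n)) (hx : MemH1 a b x) (h : WeakH1Tendsto a b xs x) :
    TendstoUniformlyOn xs x atTop (Icc a b) := by
  obtain ⟨C, hC0, hC⟩ := h.exists_eLpNorm_deriv_le hxs
  rw [tendstoUniformlyOn_iff_tendstoUniformly_comp_coe]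
  let F : ℕ → Icc a b → ℂ := fun n => xs n ∘ (↑)
  have heq : Equicontinuous F := by
    refine Metric.equicontinuous_of_continuity_modulus (fun r => C * Real.sqrt r) ?_ F ?_
    · have : Continuous fun r : ℝ => C * Real.sqrt r := by fun_prop
      simpa using this.tendsto 0
    · intro s t n
      exact dist_le_mul_sqrt_of_eLpNorm_deriv_le hC0 (hxs n) (hC n) s.2 t.2
  have hpt : Tendsto F atTop (𝓝 (x ∘ (↑))) :=
    tendsto_pi_nhds.2 fun t => h.tendsto_apply hab hxs hx t.2
  have h1 := (heq.tendsto_uniformFun_iff_pi atTop _).2 hpt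
  exact UniformFun.tendsto_iff_tendstoUniformly.1 h1

theorem endpoints_of_mem_Gamma {m α φm φp T S : ℝ} (hS : 0 < S)
    (hx : x ∈ Gamma m α φm φp T S) :
    x (-S) = xbar m α φm φp (-T) ∧ x S = xbar m α φm φp T := by
  obtain ⟨hx1, xs, hxs, hw⟩ := hx
  have hab : -S < S := by linarith
  have hH : ∀ n, MemH1 (-S) S (xs n) := fun n => (hxs n).1
  exact ⟨tendsto_nhds_unique (hw.tendsto_apply hab hH hx1 ⟨le_rfl, hab.le⟩)
      (by simp only [fun n => (hxs n).2.2.1]; exact tendsto_const_nhds),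
    tendsto_nhds_unique (hw.tendsto_apply hab hH hx1 ⟨hab.le, le_rfl⟩)
      (by simp only [fun n => (hxs n).2.2.2.1]; exact tendsto_const_nhds)⟩

/-- A collision-free curve in the weak closure has the argument of the approximating curves. -/
theorem mem_GammaStar_of_mem_Gamma {m α φm φp T S : ℝ} (hS : 0 < S)
    (hx : x ∈ Gamma m α φm φp T S) (h0 : ∀ t ∈ Icc (-S) S, x t ≠ 0) :
    x ∈ GammaStar m α φm φp T S := by
  obtain ⟨el, er⟩ := endpoints_of_mem_Gamma hS hx
  obtain ⟨hx1, xs, hxs, hw⟩ := hx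
  have hab : -S < S := by linarith
  have hl : -S ∈ Icc (-S) S := ⟨le_rfl, hab.le⟩
  have hr : S ∈ Icc (-S) S := ⟨hab.le, le_rfl⟩
  have hH : ∀ n, MemH1 (-S) S (xs n) := fun n => (hxs n).1
  have hu := hw.tendstoUniformlyOn hab hH hx1
  have hc := hx1.continuousOn hab.le
  obtain ⟨t₀, ht₀, hmin⟩ := isCompact_Icc.exists_isMinOn ⟨_, hl⟩ hc.norm
  have hpos : 0 < ‖x t₀‖ := norm_pos_iff.2 (h0 t₀ ht₀)
  obtain ⟨n, hn⟩ := (Metric.tendstoUniformlyOn_iff.1 hu _ hpos).exists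
  obtain ⟨-, hne, hnl, hnr, θ, hθc, hθ, hθl, hθr⟩ := hxs n
  have harg : ∀ z : ℂ, z ≠ 0 → Complex.exp ((Real.log ‖z‖ : ℂ)) = ‖z‖ := by
    intro z hz
    rw [← Complex.ofReal_exp, Real.exp_log (norm_pos_iff.2 hz)]
  have hstart : Complex.exp ((Real.log ‖x (-S)‖ : ℂ) + φm * Complex.I) = x (-S) := by
    rw [Complex.exp_add, harg _ (h0 _ hl), el, ← hnl, ← hθl]
    exact (hθ _ hl).symm
  have hu' : uIcc (-S) S = Icc (-S) S := uIcc_of_le hab.le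
  obtain ⟨ℓ, hℓ, hℓl, hexp, -⟩ := hx1.1.exists_log_lift (by rwa [hu']) hstart
  rw [hu'] at hexp
  have hℓc : ContinuousOn ℓ (Icc (-S) S) := by simpa [hu'] using hℓ.continuousOn
  have hlift : ∀ t ∈ Icc (-S) S, x t = (‖x t‖ : ℂ) * Complex.exp (((ℓ t).im : ℂ) * Complex.I) := by
    intro t ht
    rw [← hexp t ht, Complex.norm_exp, Complex.ofReal_exp, ← Complex.exp_add, Complex.re_add_im]
  have hslit : ∀ t ∈ Icc (-S) S, xs n t / x t ∈ Complex.slitPlane := by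
    intro t ht
    have h1 : ‖xs n t / x t - 1‖ < 1 := by
      rw [div_sub_one (h0 t ht), norm_div, div_lt_one (norm_pos_iff.2 (h0 t ht)), ← dist_eq_norm,
        dist_comm]
      exact (hn t ht).trans_le (hmin ht)
    have h2 := (Complex.abs_re_le_norm (xs n t / x t - 1)).trans_lt h1
    rw [Complex.sub_re, Complex.one_re, abs_lt] at h2
    exact Or.inl (by linarith [h2.1])
  have hxc := (hH n).continuousOn hab.le
  have hac : ContinuousOn (fun t => (ℓ t).im + (xs n t / x t).arg) (Icc (-S) S) := by
    refine (Complex.continuous_im.comp_continuousOn hℓc).add fun t ht => ?_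
    exact ContinuousAt.comp_continuousWithinAt (f := fun t => xs n t / x t)
      (Complex.continuousAt_arg (hslit t ht)) ((hxc.div hc h0) t ht)
  have heq : EqOn θ (fun t => (ℓ t).im + (xs n t / x t).arg) (Icc (-S) S) := by
    refine eqOn_of_exp_mul_I_eq hθc hac ?_ fun t ht => ?_
    · rw [hθl, hℓl, hnl, el, div_self (by rw [← el]; exact h0 _ hl)]
      simp
    · have h1 : (‖xs n t‖ : ℂ) ≠ 0 := by simpa using hne t ht
      apply mul_left_cancel₀ h1
      rw [← hθ t ht]
      have h2 := Complex.norm_mul_exp_arg_mul_I (xs n t / x t)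
      have h3 := hlift t ht
      have h4 : (‖x t‖ : ℂ) ≠ 0 := by simpa using h0 t ht
      push_cast
      rw [add_mul, Complex.exp_add]
      calc xs n t = x t * (xs n t / x t) := by field_simp [h0 t ht]
        _ = ((‖x t‖ : ℂ) * Complex.exp (((ℓ t).im : ℂ) * Complex.I)) *
            (‖xs n t / x t‖ * Complex.exp ((xs n t / x t).arg * Complex.I)) := by
            rw [h2, ← h3]
        _ = _ := by
            rw [norm_div, Complex.ofReal_div]
            field_simp
  refine ⟨hx1, h0, el, er, fun t => (ℓ t).im, Complex.continuous_im.comp_continuousOn hℓc, hlift,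
    ?_, ?_⟩
  · simp [hℓl]
  · have h1 := heq hr
    rw [hθr] at h1
    simp only [hnr, er, div_self (show xbar m α φm φp T ≠ 0 by rw [← er]; exact h0 _ hr)] at h1
    simpa using h1.symm

theorem GammaStar_subset_Gamma {m α φm φp T S : ℝ} :
    GammaStar m α φm φp T S ⊆ Gamma m α φm φp T S := fun x hx =>
  ⟨hx.1, fun _ => x, fun _ => hx, fun _ _ _ _ => tendsto_const_nhds⟩

end Kepler

/-! ### The flat coordinate and the lower bounds. -/

namespace Kepler

variable {m α : ℝ}

theorem potential_of_ne_zero (hα : 0 < α) {z : ℂ} (hz : z ≠ 0) :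
    potential m α z = ENNReal.ofReal (m / (α * ‖z‖ ^ α)) := by
  have hz' : 0 < ‖z‖ := norm_pos_iff.2 hz
  have h := Real.rpow_pos_of_pos hz' α
  rw [potential, ← ofReal_norm, ENNReal.ofReal_rpow_of_pos hz', ← ENNReal.ofReal_mul hα.le,
    ENNReal.ofReal_div_of_pos (by positivity)]

/-- The density of the Jacobi length, up to a constant, in the flat coordinate `z ^ (1 - α / 2)`. -/
theorem flat_speed_le (hm : 0 < m) (hα : 0 < α) (hα₂ : α < 2) (z v : ℂ) :
    ENNReal.ofReal ((1 - α / 2) * ‖z‖ ^ (-(α / 2)) * ‖v‖) ≤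
      ENNReal.ofReal ((1 - α / 2) / Real.sqrt (m / α)) *
        (‖v‖ₑ * potential m α z ^ (1 / 2 : ℝ)) := by
  -- At a collision the real power `0 ^ (-(α / 2))` is 0 by convention, so the left side vanishes.
  -- Away from it equality holds.
  rcases eq_or_ne z 0 with rfl | hz
  · rw [norm_zero, Real.zero_rpow (by linarith : -(α / 2) ≠ 0)]
    simp
  have hz' : 0 < ‖z‖ := norm_pos_iff.2 hz
  have hp := Real.rpow_pos_of_pos hz' α
  have hs : 0 < Real.sqrt (m / α) := Real.sqrt_pos.2 (by positivity)
  rw [potential_of_ne_zero hα hz, ENNReal.ofReal_rpow_of_pos (by positivity), ← ofReal_norm,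
    ← ENNReal.ofReal_mul (norm_nonneg _),
    ← ENNReal.ofReal_mul (div_nonneg (by linarith) hs.le)]
  refine ENNReal.ofReal_le_ofReal (le_of_eq ?_)
  rw [← div_div, Real.div_rpow (by positivity) hp.le, ← Real.sqrt_eq_rpow (m / α),
    ← Real.rpow_mul hz'.le, Real.rpow_neg hz'.le, show α * (1 / 2) = α / 2 by ring]
  field_simp

theorem aemeasurable_potential_comp {a b : ℝ} {x : ℝ → ℂ} (hx : ContinuousOn x (Icc a b)) :
    AEMeasurable (fun t => potential m α (x t)) (volume.restrict (Icc a b)) := by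
  have h := hx.aemeasurable (μ := volume) measurableSet_Icc
  unfold potential
  exact ((h.enorm.pow_const _).const_mul _).const_div _

/-- A lower bound for the flat length gives a lower bound for the Maupertuis functional. -/
theorem le_maupertuis_of_le_length (hm : 0 < m) (hα : 0 < α) (hα₂ : α < 2) {S D : ℝ}
    {x : ℝ → ℂ} (hx : ContinuousOn x (Icc (-S) S)) (hD : 0 ≤ D)
    (h : ENNReal.ofReal D ≤
      ∫⁻ t in Icc (-S) S, ENNReal.ofReal ((1 - α / 2) * ‖x t‖ ^ (-(α / 2)) * ‖deriv x t‖)) :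
    ENNReal.ofReal (D ^ 2 * m / (2 * α * (1 - α / 2) ^ 2)) ≤ maupertuis m α S x := by
  set ν := volume.restrict (Icc (-S) S)
  have hβ : 0 < 1 - α / 2 := by linarith
  have hs : 0 < Real.sqrt (m / α) := Real.sqrt_pos.2 (by positivity)
  set c := (1 - α / 2) / Real.sqrt (m / α) with hc
  have hc0 : 0 < c := by positivity
  have hc2 : c ^ 2 = (1 - α / 2) ^ 2 * α / m := by
    rw [hc, div_pow, Real.sq_sqrt (by positivity)]
    field_simp
  have hmeasV : AEMeasurable (fun t => potential m α (x t)) ν := aemeasurable_potential_comp hx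
  have hmeasv : AEMeasurable (fun t => ‖deriv x t‖ₑ) ν := (measurable_deriv x).enorm.aemeasurable
  have h1 : ENNReal.ofReal D ≤ ENNReal.ofReal c *
      ∫⁻ t, ‖deriv x t‖ₑ * potential m α (x t) ^ (1 / 2 : ℝ) ∂ν := by
    rw [← lintegral_const_mul' _ _ ENNReal.ofReal_ne_top]
    exact h.trans (lintegral_mono fun t => flat_speed_le hm hα hα₂ _ _)
  -- Cauchy–Schwarz between |ẋ| and V^(1/2).
  have h2 : (∫⁻ t, ‖deriv x t‖ₑ * potential m α (x t) ^ (1 / 2 : ℝ) ∂ν) ^ 2 ≤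
      (∫⁻ t, ‖deriv x t‖ₑ ^ 2 ∂ν) * ∫⁻ t, potential m α (x t) ∂ν := by
    have h3 := ENNReal.lintegral_mul_le_Lp_mul_Lq ν Real.HolderConjugate.two_two hmeasv
      (hmeasV.pow_const (1 / 2 : ℝ))
    have h4 : ∀ y : ℝ≥0∞, (y ^ (1 / 2 : ℝ)) ^ 2 = y := by
      intro y
      rw [← ENNReal.rpow_natCast, ← ENNReal.rpow_mul]
      norm_num
    have h5 : ∀ y : ℝ≥0∞, (y ^ (1 / 2 : ℝ)) ^ (2 : ℝ) = y := by
      intro y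
      rw [← ENNReal.rpow_mul]
      norm_num
    simp only [h5, ENNReal.rpow_two, Pi.mul_apply] at h3
    refine (pow_le_pow_left' h3 2).trans (le_of_eq ?_)
    rw [mul_pow, h4, h4]
  have h3 : ∫⁻ t, ‖deriv x t‖ₑ ^ 2 ∂ν = 2 * kineticIntegral (-S) S x := by
    rw [kineticIntegral, lintegral_const_mul' _ _ (by simp), ← mul_assoc,
      ENNReal.mul_inv_cancel (by simp) (by simp), one_mul]
  have h4 : ENNReal.ofReal (D ^ 2) ≤ ENNReal.ofReal (2 * c ^ 2) * maupertuis m α S x := by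
    rw [ENNReal.ofReal_pow hD]
    refine (pow_le_pow_left' h1 2).trans ?_
    rw [mul_pow]
    refine (mul_le_mul_right h2 _).trans (le_of_eq ?_)
    rw [h3, ENNReal.ofReal_mul (by norm_num), ENNReal.ofReal_pow hc0.le, maupertuis,
      potentialIntegral]
    norm_num
    ring
  have h5 : D ^ 2 * m / (2 * α * (1 - α / 2) ^ 2) = D ^ 2 / (2 * c ^ 2) := by
    rw [hc2]
    field_simp
  rw [h5, ENNReal.ofReal_div_of_pos (by positivity)]
  refine ENNReal.div_le_of_le_mul ?_
  rwa [mul_comm]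

/-- The function |z|^β is not differentiable at the origin, so the chain rule is applied to (|z|² +
ε²)^(β/2). As β/2 - 1 < 0, dropping ε² only increases the derivative bound, which is thus uniform in
ε and valid at a collision too. -/
theorem deriv_smoothed_norm_rpow_le {β ε : ℝ} (hβ : 0 < β) (hβ₁ : β < 1) (hε : 0 < ε) {x : ℝ → ℂ}
    {t : ℝ} (hx : DifferentiableAt ℝ x t) :
    ‖deriv (fun s => (((‖x s‖ ^ 2 + ε ^ 2) ^ (β / 2) : ℝ) : ℂ)) t‖ₑ ≤
      ENNReal.ofReal (β * ‖x t‖ ^ (β - 1) * ‖deriv x t‖) := by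
  have h1 := (((hx.hasDerivAt.norm_sq).add_const (ε ^ 2)).rpow_const (p := β / 2)
    (Or.inl (by positivity))).ofReal_comp
  rw [h1.deriv, ← ofReal_norm]
  refine ENNReal.ofReal_le_ofReal ?_
  rw [Complex.norm_real, Real.norm_eq_abs, abs_mul, abs_mul, abs_mul, abs_of_pos (by positivity :
    0 < β / 2), abs_of_pos (by norm_num : (0 : ℝ) < 2),
    abs_of_nonneg (by positivity : 0 ≤ (‖x t‖ ^ 2 + ε ^ 2) ^ (β / 2 - 1))]
  have h2 := abs_real_inner_le_norm (x t) (deriv x t)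
  rcases eq_or_ne (x t) 0 with h0 | h0
  · have : |inner ℝ (x t) (deriv x t)| = 0 := by simp [h0]
    rw [this]
    simp only [mul_zero, zero_mul]
    positivity
  have h0' : 0 < ‖x t‖ := norm_pos_iff.2 h0
  have h3 : (‖x t‖ ^ 2 + ε ^ 2) ^ (β / 2 - 1) ≤ ‖x t‖ ^ (β - 2) := by
    have h4 : ‖x t‖ ^ (β - 2) = (‖x t‖ ^ 2) ^ (β / 2 - 1) := by
      rw [← Real.rpow_natCast, ← Real.rpow_mul h0'.le]
      congr 1
      push_cast
      ring
    rw [h4]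
    exact Real.rpow_le_rpow_of_nonpos (by positivity) (by nlinarith) (by linarith)
  have h5 : ‖x t‖ ^ (β - 1) = ‖x t‖ * ‖x t‖ ^ (β - 2) := by
    rw [← Real.rpow_one_add' h0'.le (by linarith)]
    congr 1
    ring
  calc _ ≤ 2 * (‖x t‖ * ‖deriv x t‖) * (β / 2) * ‖x t‖ ^ (β - 2) := by gcongr
    _ = _ := by rw [h5]; ring

theorem ofReal_abs_norm_rpow_sub_le {β a b : ℝ} (hβ : 0 < β) (hβ₁ : β < 1) (hab : a ≤ b)
    {x : ℝ → ℂ} (hx : AbsolutelyContinuousOnInterval x a b) :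
    ENNReal.ofReal |‖x b‖ ^ β - ‖x a‖ ^ β| ≤
      ∫⁻ t in Icc a b, ENNReal.ofReal (β * ‖x t‖ ^ (β - 1) * ‖deriv x t‖) := by
  have key : ∀ ε : ℝ, 0 < ε → ENNReal.ofReal
      |(‖x b‖ ^ 2 + ε ^ 2) ^ (β / 2) - (‖x a‖ ^ 2 + ε ^ 2) ^ (β / 2)| ≤
      ∫⁻ t in Icc a b, ENNReal.ofReal (β * ‖x t‖ ^ (β - 1) * ‖deriv x t‖) := by
    intro ε hε
    have hφ : ContDiff ℝ 1 fun z : ℂ => (((‖z‖ ^ 2 + ε ^ 2) ^ (β / 2) : ℝ) : ℂ) := by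
      refine Complex.ofRealCLM.contDiff.comp ?_
      refine ContDiff.rpow_const_of_ne ((contDiff_norm_sq ℝ).add contDiff_const) fun z => ?_
      positivity
    have h1 := (hx.contDiff_comp hφ).enorm_sub_le_lintegral_deriv hab
    rw [← Complex.ofReal_sub, ← ofReal_norm, Complex.norm_real, Real.norm_eq_abs] at h1
    refine h1.trans (lintegral_mono_ae ?_)
    rw [ae_restrict_iff' measurableSet_Icc]
    filter_upwards [hx.ae_differentiableAt_complex] with t ht hmem
    exact deriv_smoothed_norm_rpow_le hβ hβ₁ hε (ht (by rwa [uIcc_of_le hab]))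
  have hpow : ∀ z : ℂ, (‖z‖ ^ 2 + (0 : ℝ) ^ 2) ^ (β / 2) = ‖z‖ ^ β := by
    intro z
    rw [zero_pow two_ne_zero, add_zero, ← Real.rpow_natCast, ← Real.rpow_mul (norm_nonneg z)]
    congr 1
    push_cast
    ring
  have hcont : Continuous fun ε : ℝ => ENNReal.ofReal
      |(‖x b‖ ^ 2 + ε ^ 2) ^ (β / 2) - (‖x a‖ ^ 2 + ε ^ 2) ^ (β / 2)| := by
    have h : ∀ z : ℂ, Continuous fun ε : ℝ => (‖z‖ ^ 2 + ε ^ 2) ^ (β / 2) := fun z =>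
      Continuous.rpow_const (by fun_prop) fun _ => Or.inr (by positivity)
    exact ENNReal.continuous_ofReal.comp ((h _).sub (h _)).abs
  have hlim := (hcont.tendsto 0).mono_left (nhdsWithin_le_nhds (s := Ioi 0))
  simp only [hpow] at hlim
  exact le_of_tendsto hlim (eventually_mem_nhdsWithin.mono key)

/-- The flat radius |x|^β must fall to 0 and rise again; each half costs at least its radial
variation, whatever the angle does. -/
theorem ofReal_norm_rpow_add_le_of_collision {β a b t₀ : ℝ} (hβ : 0 < β) (hβ₁ : β < 1)
    {x : ℝ → ℂ} (hx : AbsolutelyContinuousOnInterval x a b) (ht₀ : t₀ ∈ Icc a b) (h0 : x t₀ = 0) :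
    ENNReal.ofReal (‖x a‖ ^ β + ‖x b‖ ^ β) ≤
      ∫⁻ t in Icc a b, ENNReal.ofReal (β * ‖x t‖ ^ (β - 1) * ‖deriv x t‖) := by
  have hu : t₀ ∈ uIcc a b := by rwa [uIcc_of_le (ht₀.1.trans ht₀.2)]
  have h1 := ofReal_abs_norm_rpow_sub_le hβ hβ₁ ht₀.1
    (hx.mono (uIcc_subset_uIcc left_mem_uIcc hu))
  have h2 := ofReal_abs_norm_rpow_sub_le hβ hβ₁ ht₀.2
    (hx.mono (uIcc_subset_uIcc hu right_mem_uIcc))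
  rw [h0, norm_zero, Real.zero_rpow hβ.ne', zero_sub, abs_neg, abs_of_nonneg (by positivity)] at h1
  rw [h0, norm_zero, Real.zero_rpow hβ.ne', sub_zero, abs_of_nonneg (by positivity)] at h2
  rw [ENNReal.ofReal_add (by positivity) (by positivity), ← Icc_union_Ioc_eq_Icc ht₀.1 ht₀.2,
    lintegral_union measurableSet_Ioc
      (disjoint_left.2 fun t h3 h4 => absurd h3.2 (not_le.2 h4.1)),
    setLIntegral_congr (Ioc_ae_eq_Icc (a := t₀) (b := b))]
  exact add_le_add h1 h2

theorem norm_exp_sub_exp (r β φ ψ : ℝ) :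
    ‖Complex.exp (β * (r + φ * Complex.I)) - Complex.exp (β * (r + ψ * Complex.I))‖ =
      2 * Real.exp (β * r) * |Real.sin (β * (φ - ψ) / 2)| := by
  have h : Complex.exp (β * (r + φ * Complex.I)) - Complex.exp (β * (r + ψ * Complex.I)) =
      Complex.exp (β * (r + ψ * Complex.I)) *
        (Complex.exp (Complex.I * ((β * (φ - ψ) : ℝ) : ℂ)) - 1) := by
    rw [mul_sub, ← Complex.exp_add, mul_one]
    congr 2
    push_cast
    ring
  rw [h, norm_mul, Complex.norm_exp_I_mul_ofReal_sub_one, Complex.norm_exp]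
  simp
  ring

/-- The flat length of a collision-free curve with prescribed argument is at least the length of
the segment joining the images of its endpoints. -/
theorem ofReal_chord_le_length {β a b φ ψ : ℝ} (hβ : 0 < β) (hab : a ≤ b) {x : ℝ → ℂ}
    (hx : AbsolutelyContinuousOnInterval x a b) (h0 : ∀ t ∈ Icc a b, x t ≠ 0)
    {θ : ℝ → ℝ} (hθc : ContinuousOn θ (Icc a b))
    (hθ : ∀ t ∈ Icc a b, x t = (‖x t‖ : ℂ) * Complex.exp ((θ t : ℂ) * Complex.I))
    (hθa : θ a = φ) (hθb : θ b = ψ) (hnorm : ‖x a‖ = ‖x b‖) :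
    ENNReal.ofReal (2 * ‖x a‖ ^ β * |Real.sin (β * (ψ - φ) / 2)|) ≤
      ∫⁻ t in Icc a b, ENNReal.ofReal (β * ‖x t‖ ^ (β - 1) * ‖deriv x t‖) := by
  have hu : uIcc a b = Icc a b := uIcc_of_le hab
  have hl : a ∈ Icc a b := ⟨le_rfl, hab⟩
  have hr : b ∈ Icc a b := ⟨hab, le_rfl⟩
  have hlog : ∀ z : ℂ, z ≠ 0 → Complex.exp ((Real.log ‖z‖ : ℂ)) = ‖z‖ := by
    intro z hz
    rw [← Complex.ofReal_exp, Real.exp_log (norm_pos_iff.2 hz)]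
  have hstart : Complex.exp ((Real.log ‖x a‖ : ℂ) + φ * Complex.I) = x a := by
    rw [Complex.exp_add, hlog _ (h0 _ hl), ← hθa]
    exact (hθ _ hl).symm
  obtain ⟨ℓ, hℓ, hℓa, hexp, hd⟩ := hx.exists_log_lift (by rwa [hu]) hstart
  rw [hu] at hexp hd
  have hℓc : ContinuousOn ℓ (Icc a b) := by simpa [hu] using hℓ.continuousOn
  have hre : ∀ t ∈ Icc a b, (ℓ t).re = Real.log ‖x t‖ := by
    intro t ht
    rw [← hexp t ht, Complex.norm_exp, Real.log_exp]
  have him : EqOn θ (fun t => (ℓ t).im) (Icc a b) := by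
    refine eqOn_of_exp_mul_I_eq hθc (Complex.continuous_im.comp_continuousOn hℓc) ?_ ?_
    · simp [hℓa, hθa]
    · intro t ht
      have h1 : (‖x t‖ : ℂ) ≠ 0 := by simpa using h0 t ht
      apply mul_left_cancel₀ h1
      rw [← hθ t ht, ← hlog _ (h0 t ht), ← hre t ht, ← Complex.exp_add, Complex.re_add_im,
        hexp t ht]
  have hℓb : ℓ b = (Real.log ‖x a‖ : ℂ) + ψ * Complex.I := by
    rw [← Complex.re_add_im (ℓ b), hre b hr, ← hnorm, ← hθb, him hr]
  -- The curve exp(βℓ) is the branch of x^β followed along x; its speed is β |x|^(β-1) |ẋ|, so its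
  -- length dominates the chord.
  have hw : AbsolutelyContinuousOnInterval (fun t => Complex.exp (β * ℓ t)) a b :=
    hℓ.contDiff_comp (φ := fun z => Complex.exp (β * z)) (by fun_prop)
  have h1 := hw.enorm_sub_le_lintegral_deriv hab
  rw [hℓa, hℓb, ← ofReal_norm, norm_exp_sub_exp, mul_comm β (Real.log _),
    ← Real.rpow_def_of_pos (norm_pos_iff.2 (h0 a hl))] at h1
  refine h1.trans (lintegral_mono_ae ?_)
  rw [ae_restrict_iff' measurableSet_Icc]
  filter_upwards [hd] with t ht hmem
  have h2 := ((ht hmem).const_mul (β : ℂ)).cexp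
  rw [h2.deriv, ← ofReal_norm]
  refine ENNReal.ofReal_le_ofReal (le_of_eq ?_)
  have hp : 0 < ‖x t‖ := norm_pos_iff.2 (h0 t hmem)
  rw [norm_mul, norm_mul, norm_div, Complex.norm_exp, Complex.re_ofReal_mul, hre t hmem,
    mul_comm β (Real.log _), ← Real.rpow_def_of_pos hp, Complex.norm_real, Real.norm_eq_abs,
    abs_of_pos hβ, Real.rpow_sub_one hp.ne']
  ring

/-- The distance from the origin of the endpoints. -/
def radius (m α T : ℝ) : ℝ := (mu m α * T) ^ (2 / (α + 2))

theorem mu_pos (hm : 0 < m) (hα : 0 < α) : 0 < mu m α :=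
  mul_pos (by linarith) (Real.sqrt_pos.2 (by positivity))

theorem radius_pos (hm : 0 < m) (hα : 0 < α) {T : ℝ} (hT : 0 < T) : 0 < radius m α T :=
  Real.rpow_pos_of_pos (mul_pos (mu_pos hm hα) hT) _

theorem norm_xbar (hm : 0 < m) (hα : 0 < α) (φm φp t : ℝ) :
    ‖xbar m α φm φp t‖ = radius m α |t| := by
  have := mu_pos hm hα
  rw [xbar, norm_mul, Complex.norm_exp_ofReal_mul_I, mul_one, Complex.norm_real, Real.norm_eq_abs,
    radius, abs_of_nonneg (by positivity)]

/-- Half the zero-energy action of a segment, in the flat coordinate, of length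
`2 s R ^ (1 - α / 2)`. -/
def halfAction (m α T s : ℝ) : ℝ :=
  radius m α T ^ (1 - α / 2) * s * Real.sqrt (2 * m / α) / (1 - α / 2)

theorem halfAction_nonneg (hm : 0 < m) (hα : 0 < α) (hα₂ : α < 2) {T s : ℝ} (hT : 0 < T)
    (hs : 0 ≤ s) : 0 ≤ halfAction m α T s := by
  have := radius_pos hm hα hT
  have : 0 < 1 - α / 2 := by linarith
  unfold halfAction
  positivity

theorem halfAction_lt (hm : 0 < m) (hα : 0 < α) (hα₂ : α < 2) {T s s' : ℝ} (hT : 0 < T)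
    (hs : s < s') : halfAction m α T s < halfAction m α T s' := by
  have := radius_pos hm hα hT
  have : 0 < 1 - α / 2 := by linarith
  unfold halfAction
  have : 0 < Real.sqrt (2 * m / α) := Real.sqrt_pos.2 (by positivity)
  gcongr

theorem sq_halfAction (hm : 0 < m) (hα : 0 < α) (T s : ℝ) :
    halfAction m α T s ^ 2 =
      (2 * radius m α T ^ (1 - α / 2) * s) ^ 2 * m / (2 * α * (1 - α / 2) ^ 2) := by
  rw [halfAction, div_pow, mul_pow, Real.sq_sqrt (by positivity)]
  field_simp

/-- Without collision the limit still carries the prescribed argument and the chord bound applies.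
With a collision the length is at least 2 R^β, which dominates the chord because |sin| ≤ 1. -/
theorem halfAction_sq_le_maupertuis {φm φp T S : ℝ} (hm : 0 < m) (hα : 0 < α) (hα₂ : α < 2)
    (hT : 0 < T) (hS : 0 < S) {x : ℝ → ℂ} (hx : x ∈ Gamma m α φm φp T S) :
    ENNReal.ofReal
        (halfAction m α T |Real.sin ((1 - α / 2) * (φp - φm) / 2)| ^ 2) ≤ maupertuis m α S x := by
  have hab : -S ≤ S := by linarith
  have hR := radius_pos hm hα hT
  have hβ : 0 < 1 - α / 2 := by linarith
  obtain ⟨el, er⟩ := endpoints_of_mem_Gamma hS hx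
  have nl : ‖x (-S)‖ = radius m α T := by rw [el, norm_xbar hm hα, abs_neg, abs_of_pos hT]
  have nr : ‖x S‖ = radius m α T := by rw [er, norm_xbar hm hα, abs_of_pos hT]
  have hexp : (1 - α / 2) - 1 = -(α / 2) := by ring
  rw [sq_halfAction hm hα]
  refine le_maupertuis_of_le_length hm hα hα₂ (hx.1.continuousOn hab) (by positivity) ?_
  by_cases h0 : ∀ t ∈ Icc (-S) S, x t ≠ 0
  · obtain ⟨-, -, -, -, θ, hθc, hθ, hθl, hθr⟩ := mem_GammaStar_of_mem_Gamma hS hx h0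
    have h := ofReal_chord_le_length hβ hab hx.1.1 h0 hθc hθ hθl hθr (nl.trans nr.symm)
    rwa [hexp, nl] at h
  · push Not at h0
    obtain ⟨t₀, ht₀, hz⟩ := h0
    have h := ofReal_norm_rpow_add_le_of_collision hβ (by linarith) hx.1.1 ht₀ hz
    rw [hexp, nl, nr] at h
    refine (ENNReal.ofReal_le_ofReal ?_).trans h
    have := Real.abs_sin_le_one ((1 - α / 2) * (φp - φm) / 2)
    have := Real.rpow_pos_of_pos hR (1 - α / 2)
    nlinarith

theorem action_eq_add {S : ℝ} (x : ℝ → ℂ) :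
    action m α S x = kineticIntegral (-S) S x + potentialIntegral m α (-S) S x :=
  lintegral_add_left ((measurable_deriv x).enorm.pow_const 2 |>.const_mul _) _

/-- AM–GM in the form (K + P)² ≥ 4KP. -/
theorem ofReal_two_mul_le_add_of_sq_le_mul {c : ℝ} {K P : ℝ≥0∞}
    (h : ENNReal.ofReal (c ^ 2) ≤ K * P) : ENNReal.ofReal (2 * c) ≤ K + P := by
  rcases eq_or_ne K ⊤ with rfl | hK
  · simp
  rcases eq_or_ne P ⊤ with rfl | hP
  · simp
  lift K to NNReal using hK
  lift P to NNReal using hP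
  rw [← ENNReal.coe_mul, ENNReal.ofReal_le_coe] at h
  rw [← ENNReal.coe_add, ENNReal.ofReal_le_coe]
  push_cast at h ⊢
  have h1 := K.2
  have h2 := P.2
  refine abs_le_of_sq_le_sq' ?_ (by positivity) |>.2
  nlinarith [sq_nonneg ((K : ℝ) - P)]

theorem two_mul_halfAction_le_action {φm φp T S : ℝ} (hm : 0 < m) (hα : 0 < α) (hα₂ : α < 2)
    (hT : 0 < T) (hS : 0 < S) {x : ℝ → ℂ} (hx : x ∈ Gamma m α φm φp T S) :
    ENNReal.ofReal
        (2 * halfAction m α T |Real.sin ((1 - α / 2) * (φp - φm) / 2)|) ≤ action m α S x := by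
  rw [action_eq_add]
  exact ofReal_two_mul_le_add_of_sq_le_mul (halfAction_sq_le_maupertuis hm hα hα₂ hT hS hx)

end Kepler

/-! ### The zero-energy motion along the flat chord. -/

namespace Kepler

/-- The inverse of a primitive of a continuous even function bounded below by a positive
constant. -/
theorem exists_inverse_primitive {q : ℝ → ℝ} (hq : Continuous q) {q₀ : ℝ} (hq₀ : 0 < q₀)
    (hle : ∀ s, q₀ ≤ q s) (heven : ∀ s, q (-s) = q s) :
    ∃ S : ℝ, 0 < S ∧ ∃ u : ℝ → ℝ, u S = 1 ∧ u (-S) = -1 ∧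
      ∀ t, HasDerivAt u (q (u t))⁻¹ t := by
  set h : ℝ → ℝ := fun s => ∫ σ in (0 : ℝ)..s, q σ with hh
  have hd : ∀ s, HasDerivAt h (q s) s := fun s =>
    intervalIntegral.integral_hasDerivAt_right (hq.intervalIntegrable _ _)
      hq.aestronglyMeasurable.stronglyMeasurableAtFilter hq.continuousAt
  have h0 : h 0 = 0 := by simp [hh]
  have hmono : StrictMono h := by
    refine strictMono_of_deriv_pos fun s => ?_
    rw [(hd s).deriv]
    exact hq₀.trans_le (hle s)
  have hodd : ∀ s, h (-s) = -h s := by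
    intro s
    have h1 := intervalIntegral.integral_comp_neg (a := 0) (b := s) (f := q)
    simp only [heven, neg_zero] at h1
    simp only [hh, h1]
    rw [intervalIntegral.integral_symm]
  have hlin : ∀ s, 0 ≤ s → q₀ * s ≤ h s := by
    intro s hs
    have h1 := intervalIntegral.integral_mono_on (μ := volume) hs (intervalIntegrable_const (c := q₀))
      (hq.intervalIntegrable 0 s) fun σ _ => hle σ
    rw [intervalIntegral.integral_const] at h1
    simp only [sub_zero, smul_eq_mul] at h1
    linarith
  have htop : Tendsto h atTop atTop := by
    refine tendsto_atTop_mono' _ ?_ (tendsto_id.const_mul_atTop hq₀)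
    filter_upwards [eventually_ge_atTop 0] with s hs using hlin s hs
  have hbot : Tendsto h atBot atBot := by
    have h1 : h = fun s => -h (-s) := by
      funext s
      rw [hodd, neg_neg]
    rw [h1]
    exact tendsto_neg_atTop_atBot.comp (htop.comp tendsto_neg_atBot_atTop)
  have hcont : Continuous h := continuous_iff_continuousAt.2 fun s => (hd s).continuousAt
  let e := hmono.orderIsoOfSurjective h (hcont.surjective htop hbot)
  have he : ∀ s, e.symm (h s) = s := fun s => e.symm_apply_apply s
  -- Separation of variables: u is the inverse of the primitive h, and S is the time needed to go
  -- from 0 to 1.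
  refine ⟨h 1, ?_, e.symm, he 1, ?_, fun t => ?_⟩
  · rw [← h0]
    exact hmono one_pos
  · rw [← hodd]
    exact he _
  · refine HasDerivAt.of_local_left_inverse e.symm.continuous.continuousAt (hd _)
      (hq₀.trans_le (hle _)).ne' (Eventually.of_forall fun s => e.apply_symm_apply s)

/-- A straight segment, in logarithmic coordinates, in the parametrization of zero energy. -/
theorem exists_log_segment {N k γ : ℝ} (hN : 1 < N) (hk : 0 < k) (hγ : |γ| < Real.pi / 2) :
    ∃ S : ℝ, 0 < S ∧ ∃ (u : ℝ → ℝ) (L : ℝ → ℂ), u S = 1 ∧ u (-S) = -1 ∧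
      L S = γ * Complex.I ∧ L (-S) = -γ * Complex.I ∧
      (∀ t, HasDerivAt u (k * Real.exp (2 * (1 - N) * (L t).re)) t) ∧
      ∀ t, HasDerivAt L (Complex.I * Real.sin γ * (k * Real.exp (2 * (1 - N) * (L t).re)) *
        Complex.exp (-L t)) t := by
  rw [abs_lt] at hγ
  have ha : 0 < Real.cos γ := Real.cos_pos_of_mem_Ioo ⟨by linarith [hγ.1], hγ.2⟩
  set a := Real.cos γ with haa
  set b := Real.sin γ with hbb
  have hpos : ∀ s : ℝ, 0 < a ^ 2 + (b * s) ^ 2 := fun s => by positivity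
  -- Here q(s) = k⁻¹ |a + i b s|^(2(N-1)) is dt/du. It is bounded below because |γ| < π/2 keeps the
  -- segment at distance at least a = cos γ from the origin.
  obtain ⟨S, hS, u, hu1, hu2, hu⟩ := exists_inverse_primitive
    (q := fun s => k⁻¹ * (a ^ 2 + (b * s) ^ 2) ^ (N - 1)) (q₀ := k⁻¹ * (a ^ 2) ^ (N - 1))
    (continuous_const.mul (Continuous.rpow_const (by fun_prop) fun s => Or.inl (hpos s).ne'))
    (by positivity)
    (fun s => mul_le_mul_of_nonneg_left
      (Real.rpow_le_rpow (by positivity) (by nlinarith [sq_nonneg (b * s)]) (by linarith))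
      (by positivity))
    (fun s => by simp)
  -- The vertical segment from exp(-iγ) to exp(iγ); it lies in the right half-plane, where the
  -- principal logarithm is smooth.
  set z : ℝ → ℂ := fun t => (a : ℂ) + (b * u t : ℝ) * Complex.I with hz
  have hzre : ∀ t, (z t).re = a := fun t => by simp [hz]
  have hzslit : ∀ t, z t ∈ Complex.slitPlane := fun t => Or.inl (by rw [hzre]; exact ha)
  have hz0 : ∀ t, z t ≠ 0 := fun t => Complex.slitPlane_ne_zero (hzslit t)
  have hznorm : ∀ t, ‖z t‖ ^ 2 = a ^ 2 + (b * u t) ^ 2 := by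
    intro t
    rw [← Complex.normSq_eq_norm_sq, Complex.normSq_apply]
    simp [hz]
    ring
  have hu' : ∀ t, HasDerivAt u (k * Real.exp (2 * (1 - N) * (Complex.log (z t)).re)) t := by
    intro t
    convert hu t using 1
    have hn : 0 < ‖z t‖ := norm_pos_iff.2 (hz0 t)
    rw [← hznorm, Complex.log_re, mul_inv, inv_inv, ← Real.rpow_natCast, ← Real.rpow_mul hn.le,
      ← Real.rpow_neg hn.le, Real.rpow_def_of_pos hn]
    congr 2
    push_cast
    ring
  have hexp : ∀ s : ℝ, |s| < Real.pi / 2 →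
      Complex.log ((Real.cos s : ℂ) + (Real.sin s : ℝ) * Complex.I) = s * Complex.I := by
    intro s hs
    rw [abs_lt] at hs
    have h1 : (Real.cos s : ℂ) + (Real.sin s : ℝ) * Complex.I = Complex.exp (s * Complex.I) := by
      rw [Complex.exp_mul_I]
      push_cast
      rfl
    rw [h1, Complex.log_exp] <;> simp <;> linarith [Real.pi_pos, hs.1, hs.2]
  refine ⟨S, hS, u, fun t => Complex.log (z t), hu1, hu2, ?_, ?_, hu', fun t => ?_⟩
  · simp only [hz, hu1, mul_one]
    exact hexp γ (abs_lt.2 hγ)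
  · simp only [hz, hu2, mul_neg, mul_one]
    have h1 := hexp (-γ) (by rw [abs_neg]; exact abs_lt.2 hγ)
    rw [Real.cos_neg, Real.sin_neg] at h1
    rw [h1]
    push_cast
    rfl
  · have hzd : HasDerivAt z (((b * (k * Real.exp (2 * (1 - N) * (Complex.log (z t)).re)) : ℝ) : ℂ) *
        Complex.I) t := by
      exact ((((hu' t).const_mul b).ofReal_comp).mul_const Complex.I).const_add (a : ℂ)
    have h1 := hzd.clog_real (hzslit t)
    convert h1 using 1
    rw [Complex.exp_neg, Complex.exp_log (hz0 t)]
    push_cast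
    field_simp

/-- The data of a collision-free zero-energy solution minimizing the Jacobi length. -/
theorem exists_zeroEnergy_solution {m α T φm φp : ℝ} (hm : 0 < m) (hα : 0 < α) (hα₂ : α < 2)
    (hT : 0 < T) (hγ : |(1 - α / 2) * (φp - φm) / 2| < Real.pi / 2)
    (hγ₀ : (1 - α / 2) * (φp - φm) / 2 ≠ 0) :
    ∃ S : ℝ, 0 < S ∧ ∃ (x v : ℝ → ℂ) (θ u u' : ℝ → ℝ),
      (∀ t, x t ≠ 0) ∧ (∀ t, HasDerivAt x (v t) t) ∧
      (∀ t, HasDerivAt v (-(m / ‖x t‖ ^ (α + 2)) • x t) t) ∧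
      (∀ t, ‖v t‖ ^ 2 / 2 - m / (α * ‖x t‖ ^ α) = 0) ∧
      Continuous θ ∧ (∀ t, x t = (‖x t‖ : ℂ) * Complex.exp ((θ t : ℂ) * Complex.I)) ∧
      θ (-S) = φm ∧ θ S = φp ∧ ‖x (-S)‖ = radius m α T ∧ ‖x S‖ = radius m α T ∧
      Continuous u' ∧ (∀ t, HasDerivAt u (u' t) t) ∧ u S = 1 ∧ u (-S) = -1 ∧
      ∀ t, ‖v t‖ ^ 2 =
        halfAction m α T |Real.sin ((1 - α / 2) * (φp - φm) / 2)| * u' t := by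
  set β := 1 - α / 2 with hβd
  have hβ : 0 < β := by linarith
  have hβ1 : β < 1 := by linarith
  set γ := β * (φp - φm) / 2 with hγd
  set N := β⁻¹ with hN
  have hN1 : 1 < N := (one_lt_inv₀ hβ).2 hβ1
  have hNβ : N * β = 1 := inv_mul_cancel₀ hβ.ne'
  have hNα : N * α = 2 * N - 2 := by
    have : α = 2 - 2 * β := by rw [hβd]; ring
    rw [this]
    linear_combination -2 * hNβ
  set b := Real.sin γ with hb
  have hpi := Real.pi_pos
  have hb0 : b ≠ 0 := by
    rw [hb]
    rw [abs_lt] at hγ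
    exact fun h => hγ₀ ((Real.sin_eq_zero_iff_of_lt_of_lt (by linarith) (by linarith)).1 h)
  set R := radius m α T with hR
  have hR0 : 0 < R := radius_pos hm hα hT
  set B := halfAction m α T |b| with hB
  have hB0 : 0 < B := by
    have : 0 < Real.sqrt (2 * m / α) := Real.sqrt_pos.2 (by positivity)
    have : 0 < |b| := abs_pos.2 hb0
    rw [hB, halfAction, ← hR, ← hβd]
    positivity
  have hN0 : 0 < N := by linarith
  -- This rate makes |v|² = B u', so that integrals of |v|² are read off from u. By `hk2` it is also
  -- exactly the rate that gives zero energy.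
  set k := B / (R ^ 2 * N ^ 2 * b ^ 2) with hk
  have hk0 : 0 < k := by positivity
  have hBk : R ^ 2 * N ^ 2 * b ^ 2 * k = B := by rw [hk]; field_simp
  have hRpow : R ^ (α + 2) * R ^ (2 * β) = R ^ 4 := by
    rw [← Real.rpow_add hR0, ← Real.rpow_natCast]
    congr 1
    rw [hβd]
    push_cast
    ring
  have hk2 : N ^ 2 * b ^ 2 * k ^ 2 * R ^ (α + 2) = 2 * m / α := by
    have hB2 : B ^ 2 = R ^ (2 * β) * b ^ 2 * (2 * m / α) * N ^ 2 := by
      rw [hB, halfAction, ← hR, ← hβd, div_pow, mul_pow, mul_pow, sq_abs,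
        Real.sq_sqrt (by positivity), hN, inv_pow, div_eq_mul_inv, mul_comm 2 β,
        Real.rpow_mul hR0.le, Real.rpow_two]
    have h1 : R ^ 4 * (N ^ 2 * b ^ 2 * k ^ 2 * R ^ (α + 2)) * (N ^ 2 * b ^ 2) =
        R ^ 4 * (2 * m / α) * (N ^ 2 * b ^ 2) := by
      calc _ = (R ^ 2 * N ^ 2 * b ^ 2 * k) ^ 2 * R ^ (α + 2) := by ring
        _ = (R ^ (α + 2) * R ^ (2 * β)) * (b ^ 2 * (2 * m / α) * N ^ 2) := by
          rw [hBk, hB2]; ring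
        _ = _ := by rw [hRpow]; ring
    have h2 := mul_right_cancel₀ (by positivity) h1
    exact mul_left_cancel₀ (by positivity) h2
  obtain ⟨S, hS, u, L, hu1, hu2, hL1, hL2, hu, hL⟩ := exists_log_segment hN1 hk0 hγ
  rw [← hb] at hL
  set φ := (φp + φm) / 2 with hφ
  have hLc : Continuous L := continuous_iff_continuousAt.2 fun t => (hL t).continuousAt
  set x : ℝ → ℂ := fun t => R * Complex.exp (φ * Complex.I) * Complex.exp (N * L t) with hx
  -- With w = exp L one has x = R exp(iφ) w^N, and w^(N-1) |w|^(2(1-N)) is the conjugate of w to the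
  -- power 1 - N. In this form a single differentiation of v yields Newton's equation.
  set v : ℝ → ℂ := fun t => Complex.I * R * Complex.exp (φ * Complex.I) * (N * b * k) *
    Complex.exp ((1 - N) * (starRingEnd ℂ) (L t)) with hv
  have hxn : ∀ t, ‖x t‖ = R * Real.exp (N * (L t).re) := by
    intro t
    simp only [hx, norm_mul, Complex.I_re, mul_zero, Real.exp_zero, Complex.norm_real, Complex.norm_exp,
      Complex.re_ofReal_mul, Real.norm_eq_abs, abs_of_pos hR0, mul_one]
  have hvn : ∀ t, ‖v t‖ ^ 2 = R ^ 2 * N ^ 2 * b ^ 2 * k ^ 2 *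
      Real.exp (2 * (1 - N) * (L t).re) := by
    intro t
    have h1 : ((1 : ℂ) - N) = ((1 - N : ℝ) : ℂ) := by push_cast; rfl
    simp only [hv, h1, norm_mul, Complex.I_re, mul_zero, Real.exp_zero, Complex.norm_real, Complex.norm_exp,
      Complex.re_ofReal_mul, Complex.conj_re, mul_one, Complex.norm_I, one_mul, mul_pow,
      Real.norm_eq_abs, sq_abs, ← Real.exp_nat_mul]
    push_cast
    ring_nf
  have hxp : ∀ (t s : ℝ), ‖x t‖ ^ s = R ^ s * Real.exp (N * s * (L t).re) := by
    intro t s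
    rw [hxn, Real.mul_rpow hR0.le (Real.exp_pos _).le, ← Real.exp_mul]
    ring_nf
  have hsum : ∀ t, (((L t).re : ℝ) : ℂ) = (L t + (starRingEnd ℂ) (L t)) / 2 := by
    intro t
    rw [Complex.add_conj]
    push_cast
    ring
  refine ⟨S, hS, x, v, fun t => φ + N * (L t).im, u,
    fun t => k * Real.exp (2 * (1 - N) * (L t).re), ?_, ?_, ?_, ?_, ?_, ?_, ?_, ?_, ?_, ?_, ?_, hu,
    hu1, hu2, ?_⟩
  · intro t
    rw [← norm_pos_iff, hxn]
    positivity
  · intro t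
    have h1 := (((hL t).const_mul (N : ℂ)).cexp).const_mul (R * Complex.exp (φ * Complex.I))
    refine h1.congr_deriv ?_
    simp only [hv]
    push_cast
    rw [hsum]
    have h2 : Complex.exp ((1 - N) * (starRingEnd ℂ) (L t)) = Complex.exp (N * L t) *
        (Complex.exp (2 * (1 - N) * ((L t + (starRingEnd ℂ) (L t)) / 2)) *
          Complex.exp (-L t)) := by
      rw [← Complex.exp_add, ← Complex.exp_add]
      congr 1
      ring
    rw [h2]
    ring
  · intro t
    have hc : HasDerivAt (fun t => (starRingEnd ℂ) (L t)) ((starRingEnd ℂ) (Complex.I * b *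
        (k * Real.exp (2 * (1 - N) * (L t).re)) * Complex.exp (-L t))) t :=
      Complex.conjCLE.hasFDerivAt.comp_hasDerivAt t (hL t)
    have h1 := ((hc.const_mul (1 - (N : ℂ))).cexp).const_mul
      (Complex.I * R * Complex.exp (φ * Complex.I) * (N * b * k))
    refine h1.congr_deriv ?_
    have h3 : m / ‖x t‖ ^ (α + 2) = N * (N - 1) * b ^ 2 * k ^ 2 *
        Real.exp (2 * (1 - 2 * N) * (L t).re) := by
      rw [hxp, div_eq_iff (by positivity)]
      have h4 : Real.exp (2 * (1 - 2 * N) * (L t).re) * Real.exp (N * (α + 2) * (L t).re) = 1 := by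
        rw [← Real.exp_add, Real.exp_eq_one_iff]
        linear_combination (L t).re * hNα
      have h5 : N * (N - 1) * b ^ 2 * k ^ 2 * R ^ (α + 2) = m := by
        have h6 : 2 * m = N ^ 2 * b ^ 2 * k ^ 2 * R ^ (α + 2) * α := by
          rw [hk2]; field_simp
        have h7 : N ^ 2 * α = 2 * (N * (N - 1)) := by linear_combination N * hNα
        linear_combination (-1 / 2) * h6 - (b ^ 2 * k ^ 2 * R ^ (α + 2) / 2) * h7
      calc m = (N * (N - 1) * b ^ 2 * k ^ 2 * R ^ (α + 2)) *
            (Real.exp (2 * (1 - 2 * N) * (L t).re) * Real.exp (N * (α + 2) * (L t).re)) := by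
            rw [h4, h5, mul_one]
        _ = _ := by ring
    rw [h3]
    simp only [hx, map_mul, Complex.conj_I, Complex.conj_ofReal, ← Complex.exp_conj, map_neg,
      Complex.real_smul]
    push_cast
    rw [hsum]
    have h2 : Complex.exp ((1 - N) * (starRingEnd ℂ) (L t)) *
        (Complex.exp (2 * (1 - N) * ((L t + (starRingEnd ℂ) (L t)) / 2)) *
          Complex.exp (-(starRingEnd ℂ) (L t))) =
        Complex.exp (2 * (1 - 2 * N) * ((L t + (starRingEnd ℂ) (L t)) / 2)) *
          Complex.exp (N * L t) := by
      rw [← Complex.exp_add, ← Complex.exp_add, ← Complex.exp_add]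
      congr 1
      ring
    linear_combination (R * Complex.exp (φ * Complex.I) * (N * b * k) * (1 - N) * b * k) * h2
      - (R * Complex.exp (φ * Complex.I) * (N * b * k) * (1 - N) * b * k) *
        (Complex.exp ((1 - N) * (starRingEnd ℂ) (L t)) *
        (Complex.exp (2 * (1 - N) * ((L t + (starRingEnd ℂ) (L t)) / 2)) *
          Complex.exp (-(starRingEnd ℂ) (L t)))) * Complex.I_sq
  · intro t
    rw [hvn, hxp, hNα]
    have h4 : Real.exp (2 * (1 - N) * (L t).re) * Real.exp ((2 * N - 2) * (L t).re) = 1 := by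
      rw [← Real.exp_add, Real.exp_eq_one_iff]
      ring
    have h5 : N ^ 2 * b ^ 2 * k ^ 2 * (R ^ α * R ^ 2) * α = 2 * m := by
      rw [← Real.rpow_two R, ← Real.rpow_add hR0, hk2]
      field_simp
    rw [sub_eq_zero, eq_div_iff (by positivity)]
    linear_combination (1 / 2) * h5 +
      (N ^ 2 * b ^ 2 * k ^ 2 * (R ^ α * R ^ 2) * α / 2) * h4
  · fun_prop
  · intro t
    rw [hxn]
    simp only [hx]
    push_cast
    rw [mul_assoc, mul_assoc, ← Complex.exp_add, ← Complex.exp_add]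
    congr 2
    nth_rewrite 1 [← Complex.re_add_im (L t)]
    ring
  · simp only [hL2]
    simp [hγd]
    linear_combination (-(φp - φm) / 2) * hNβ
  · simp only [hL1]
    simp [hγd]
    linear_combination ((φp - φm) / 2) * hNβ
  · rw [hxn, hL2]
    simp
  · rw [hxn, hL1]
    simp
  · have := Complex.continuous_re.comp hLc
    fun_prop
  · intro t
    rw [hvn, ← hBk]
    ring

end Kepler

/-! ### Values of the functionals on the chord motion and on x̄. -/

namespace Kepler

theorem lintegral_Icc_ofReal_deriv {f f' : ℝ → ℝ} (hc : Continuous f')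
    (hd : ∀ t, HasDerivAt f (f' t) t) (h0 : ∀ t, 0 ≤ f' t) {a b : ℝ} (hab : a ≤ b) :
    ∫⁻ t in Icc a b, ENNReal.ofReal (f' t) = ENNReal.ofReal (f b - f a) := by
  rw [← ofReal_integral_eq_lintegral_ofReal (hc.integrableOn_Icc) (Eventually.of_forall h0),
    integral_Icc_eq_integral_Ioc, ← intervalIntegral.integral_of_le hab,
    intervalIntegral.integral_eq_sub_of_hasDerivAt (fun t _ => hd t) (hc.intervalIntegrable _ _)]

theorem two_inv_mul_enorm_sq (z : ℂ) : 2⁻¹ * ‖z‖ₑ ^ 2 = ENNReal.ofReal (‖z‖ ^ 2 / 2) := by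
  rw [← ofReal_norm, ← ENNReal.ofReal_pow (norm_nonneg z), div_eq_inv_mul,
    ENNReal.ofReal_mul (by norm_num), ENNReal.ofReal_inv_of_pos (by norm_num)]
  norm_num

theorem memH1_of_hasDerivAt {x v : ℝ → ℂ} (hx : ∀ t, HasDerivAt x (v t) t) (hv : Continuous v)
    (a b : ℝ) : MemH1 a b x := by
  have hd : deriv x = v := funext fun t => (hx t).deriv
  constructor
  · refine ContDiffOn.absolutelyContinuousOnInterval (ContDiff.contDiffOn ?_)
    rw [contDiff_one_iff_deriv, hd]
    exact ⟨fun t => (hx t).differentiableAt, hv⟩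
  · rw [hd]
    obtain ⟨C, hC⟩ := isCompact_Icc.exists_bound_of_continuousOn (hv.continuousOn (s := Icc a b))
    refine MemLp.of_bound hv.aestronglyMeasurable C ?_
    exact (ae_restrict_iff' measurableSet_Icc).2 (Eventually.of_forall hC)

theorem exp_mul_norm_eq_xbar {m α T φm φp : ℝ} (hT : 0 < T) :
    (radius m α T : ℂ) * Complex.exp (φm * Complex.I) = xbar m α φm φp (-T) ∧
      (radius m α T : ℂ) * Complex.exp (φp * Complex.I) = xbar m α φm φp T := by
  simp only [xbar, radius, abs_neg, abs_of_pos hT, if_pos hT.le,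
    if_neg (show ¬ 0 ≤ -T by linarith), and_self]

/-- A collision-free zero-energy solution joining the endpoints such that, after any linear change
of time, both factors of the Maupertuis functional are known. -/
theorem exists_zeroEnergy_minimizer {m α T φm φp : ℝ} (hm : 0 < m) (hα : 0 < α) (hα₂ : α < 2)
    (hT : 0 < T) (hγ : |(1 - α / 2) * (φp - φm) / 2| < Real.pi / 2)
    (hγ₀ : (1 - α / 2) * (φp - φm) / 2 ≠ 0) :
    ∃ S : ℝ, 0 < S ∧ ∃ x : ℝ → ℂ, IsZeroEnergySolution m α (-S) S x ∧
      ∀ c : ℝ, 0 < c → (fun t => x (c * t)) ∈ GammaStar m α φm φp T (S / c) ∧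
        kineticIntegral (-(S / c)) (S / c) (fun t => x (c * t)) = ENNReal.ofReal
          (c * halfAction m α T |Real.sin ((1 - α / 2) * (φp - φm) / 2)|) ∧
        potentialIntegral m α (-(S / c)) (S / c) (fun t => x (c * t)) = ENNReal.ofReal
          (halfAction m α T |Real.sin ((1 - α / 2) * (φp - φm) / 2)| / c) := by
  obtain ⟨S, hS, x, v, θ, u, u', hx0, hxd, hvd, hE, hθc, hθ, hθl, hθr, hnl, hnr, hu'c, hu, hu1,
    hu2, hv2⟩ := exists_zeroEnergy_solution hm hα hα₂ hT hγ hγ₀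
  set B := halfAction m α T |Real.sin ((1 - α / 2) * (φp - φm) / 2)| with hB
  refine ⟨S, hS, x, ⟨v, fun t _ => ⟨hx0 t, (hxd t).hasDerivWithinAt, (hvd t).hasDerivWithinAt,
    hE t⟩⟩, fun c hc => ?_⟩
  have hcS : c * (S / c) = S := mul_div_cancel₀ S hc.ne'
  have hcS' : c * -(S / c) = -S := by rw [mul_neg, hcS]
  have hvc : Continuous v := continuous_iff_continuousAt.2 fun t => (hvd t).continuousAt
  have hlin : ∀ t : ℝ, HasDerivAt (fun t => c * t) c t := fun t => by
    simpa using (hasDerivAt_id t).const_mul c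
  have hyd : ∀ t, HasDerivAt (fun t => x (c * t)) (c • v (c * t)) t := fun t =>
    (hxd (c * t)).scomp t (hlin t)
  have hud : ∀ t, HasDerivAt (fun t => u (c * t)) (u' (c * t) * c) t := fun t =>
    (hu (c * t)).comp t (hlin t)
  have hab : -(S / c) ≤ S / c := by linarith [div_pos hS hc]
  have hBu : ∀ t, 0 ≤ B * u' t := fun t => by rw [← hv2]; positivity
  have hu'c' : Continuous fun t => u' (c * t) := by fun_prop
  have hends := exp_mul_norm_eq_xbar (m := m) (α := α) (φm := φm) (φp := φp) hT
  refine ⟨⟨memH1_of_hasDerivAt hyd (by fun_prop) _ _, fun t _ => hx0 _, ?_, ?_,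
    fun t => θ (c * t), by fun_prop, fun t _ => hθ _, ?_, ?_⟩, ?_, ?_⟩
  · simp only [hcS']
    rw [hθ, hnl, hθl, hends.1]
  · simp only [hcS]
    rw [hθ, hnr, hθr, hends.2]
  · simp only [hcS', hθl]
  · simp only [hcS, hθr]
  -- The integrand is (c B / 2) times the derivative of u(ct), and u increases by 2 in total.
  · have h1 : ∀ t, 2⁻¹ * ‖deriv (fun t => x (c * t)) t‖ₑ ^ 2 =
        ENNReal.ofReal (c * B / 2 * (u' (c * t) * c)) := by
      intro t
      rw [(hyd t).deriv, two_inv_mul_enorm_sq, norm_smul, mul_pow, hv2, Real.norm_eq_abs, sq_abs]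
      congr 1
      ring
    simp only [kineticIntegral, h1]
    rw [lintegral_Icc_ofReal_deriv (by fun_prop) (fun t => (hud t).const_mul (c * B / 2))
      (fun t => by have := hBu (c * t); nlinarith [sq_nonneg c]) hab, hcS, hcS', hu1, hu2]
    congr 1
    ring
  -- Zero energy replaces the potential by |v|²/2 = B u'/2.
  · have h1 : ∀ t, potential m α (x (c * t)) =
        ENNReal.ofReal (B / (2 * c) * (u' (c * t) * c)) := by
      intro t
      rw [potential_of_ne_zero hα (hx0 _), ← sub_eq_zero.1 (hE (c * t)), hv2]
      congr 1
      field_simp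
    simp only [potentialIntegral, h1]
    rw [lintegral_Icc_ofReal_deriv (by fun_prop) (fun t => (hud t).const_mul (B / (2 * c)))
      (fun t => by
        have := hBu (c * t)
        have h2 : B / (2 * c) * (u' (c * t) * c) = B * u' (c * t) / 2 := by field_simp
        rw [h2]
        positivity) hab, hcS, hcS', hu1, hu2]
    congr 1
    field_simp
    ring

theorem hasDerivAt_radius_abs {m α t : ℝ} (hm : 0 < m) (hα : 0 < α) (ht : t ≠ 0) :
    HasDerivAt (fun s => radius m α |s|) (mu m α * (SignType.sign t : ℝ) * (2 / (α + 2)) *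
      (mu m α * |t|) ^ (2 / (α + 2) - 1)) t := by
  have := mu_pos hm hα
  have h0 : 0 < |t| := abs_pos.2 ht
  exact ((hasDerivAt_abs ht).const_mul (mu m α)).rpow_const (Or.inl (by positivity))

theorem continuous_radius {m α : ℝ} (hα : 0 < α) : Continuous (radius m α) := by
  unfold radius
  exact Continuous.rpow_const (by fun_prop) fun _ => Or.inr (by positivity)

theorem xbar_eq (m α φm φp t : ℝ) : xbar m α φm φp t = (radius m α |t| : ℂ) *
    Complex.exp (((if 0 ≤ t then φp else φm : ℝ) : ℂ) * Complex.I) := rfl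

theorem hasDerivAt_xbar {m α φm φp t : ℝ} (hm : 0 < m) (hα : 0 < α) (ht : t ≠ 0) :
    HasDerivAt (xbar m α φm φp) (((mu m α * (SignType.sign t : ℝ) * (2 / (α + 2)) *
      (mu m α * |t|) ^ (2 / (α + 2) - 1) : ℝ) : ℂ) *
        Complex.exp (((if 0 ≤ t then φp else φm : ℝ) : ℂ) * Complex.I)) t := by
  refine ((hasDerivAt_radius_abs hm hα ht).ofReal_comp.mul_const _).congr_of_eventuallyEq ?_
  rcases lt_or_gt_of_ne ht with h | h
  · filter_upwards [Iio_mem_nhds h] with s hs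
    rw [xbar_eq, if_neg (not_le.2 hs), if_neg (not_le.2 h)]
  · filter_upwards [Ioi_mem_nhds h] with s hs
    rw [xbar_eq, if_pos (le_of_lt hs), if_pos h.le]

theorem norm_deriv_xbar {m α φm φp t : ℝ} (hm : 0 < m) (hα : 0 < α) (ht : t ≠ 0) :
    ‖deriv (xbar m α φm φp) t‖ =
      mu m α * (2 / (α + 2)) * (mu m α * |t|) ^ (2 / (α + 2) - 1) := by
  have hμ := mu_pos hm hα
  rw [(hasDerivAt_xbar hm hα ht).deriv, norm_mul, Complex.norm_exp_ofReal_mul_I, mul_one,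
    Complex.norm_real, Real.norm_eq_abs, abs_mul, abs_mul, abs_mul, abs_of_pos hμ,
    abs_of_pos (show 0 < 2 / (α + 2) by positivity), abs_of_nonneg (by positivity :
      0 ≤ (mu m α * |t|) ^ (2 / (α + 2) - 1))]
  have : |(SignType.sign t : ℝ)| = 1 := by
    rcases lt_or_gt_of_ne ht with h | h <;> simp [h]
  rw [this, mul_one]

theorem continuous_xbar {m α φm φp : ℝ} (hm : 0 < m) (hα : 0 < α) :
    Continuous (xbar m α φm φp) := by
  refine continuous_iff_continuousAt.2 fun t => ?_
  rcases eq_or_ne t 0 with rfl | ht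
  · have h0 : radius m α |0| = 0 := by
      rw [radius, abs_zero, mul_zero, Real.zero_rpow (by positivity)]
    have hx0 : xbar m α φm φp 0 = 0 := by
      rw [← norm_eq_zero, norm_xbar hm hα, h0]
    rw [ContinuousAt, hx0, tendsto_zero_iff_norm_tendsto_zero]
    simp only [norm_xbar hm hα]
    have : Continuous fun t => radius m α |t| := (continuous_radius hα).comp continuous_abs
    have h := this.tendsto 0
    rwa [h0] at h
  · exact (hasDerivAt_xbar hm hα ht).continuousAt

theorem lintegral_rpow_abs {c μ q T : ℝ} (hc : 0 ≤ c) (hμ : 0 < μ) (hq : -1 < q) (hT : 0 ≤ T) :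
    IntegrableOn (fun t => c * (μ * |t|) ^ q) (Icc (-T) T) ∧
    ∫⁻ t in Icc (-T) T, ENNReal.ofReal (c * (μ * |t|) ^ q) =
      ENNReal.ofReal (2 * (c * ((μ * T) ^ (q + 1) / (μ * (q + 1))))) := by
  set f : ℝ → ℝ := fun t => c * (μ * |t|) ^ q with hf
  have e : EqOn (fun t => c * μ ^ q * t ^ q) f (Icc 0 T) := by
    intro t ht
    simp only [hf]
    rw [abs_of_nonneg ht.1, Real.mul_rpow hμ.le ht.1, mul_assoc]
  have e' : EqOn (fun t => c * μ ^ q * t ^ q) f (uIcc 0 T) := by rwa [uIcc_of_le hT]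
  have i0 : IntervalIntegrable f volume 0 T :=
    ((intervalIntegral.intervalIntegrable_rpow' hq).const_mul (c * μ ^ q)).congr
      (e'.mono uIoc_subset_uIcc)
  have heven : ∀ t, f (-t) = f t := fun t => by simp [hf]
  have i1 : IntervalIntegrable f volume (-T) 0 := by
    have h := (IntervalIntegrable.iff_comp_neg (f := f)).1 i0
    simp only [heven, neg_zero] at h
    exact h.symm
  have hab : -T ≤ T := by linarith
  have hint : IntegrableOn f (Icc (-T) T) :=
    (intervalIntegrable_iff_integrableOn_Icc_of_le hab).1 (i1.trans i0)
  refine ⟨hint, ?_⟩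
  have h1 := intervalIntegral.integral_comp_neg (a := 0) (b := T) (f := f)
  simp only [heven, neg_zero] at h1
  rw [← ofReal_integral_eq_lintegral_ofReal hint (Eventually.of_forall fun t => by positivity),
    integral_Icc_eq_integral_Ioc, ← intervalIntegral.integral_of_le hab,
    ← intervalIntegral.integral_add_adjacent_intervals i1 i0, ← h1,
    ← intervalIntegral.integral_congr e', intervalIntegral.integral_const_mul,
    integral_rpow (Or.inl hq), Real.zero_rpow (by linarith), Real.mul_rpow hμ.le hT,
    Real.rpow_add_one hμ.ne']
  congr 1
  have : q + 1 ≠ 0 := by linarith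
  field_simp
  ring

/-- The speed of x̄ behaves like |t|^(-α/(α+2)) at the collision, and its square is integrable
exactly because α < 2. -/
theorem neg_one_lt_two_mul_exponent {α : ℝ} (hα : 0 < α) (hα₂ : α < 2) :
    -1 < 2 * (2 / (α + 2) - 1) := by
  have : 1 / 2 < 2 / (α + 2) := by rw [div_lt_div_iff₀ (by norm_num) (by linarith)]; linarith
  linarith

/-- Common value of the kinetic and potential integrals of x̄, which has zero energy off t = 0. The
exponent of μT equals (2/(α+2))β, which turns the power into R^β. -/
theorem two_mul_rpow_eq_halfAction {m α T : ℝ} (hm : 0 < m) (hα : 0 < α) (hα₂ : α < 2)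
    (hT : 0 < T) :
    2 * (m / α * ((mu m α * T) ^ (2 * (2 / (α + 2) - 1) + 1) /
      (mu m α * (2 * (2 / (α + 2) - 1) + 1)))) = halfAction m α T 1 := by
  have hμ := mu_pos hm hα
  have hs : 0 < Real.sqrt (m / (2 * α)) := Real.sqrt_pos.2 (by positivity)
  have hexp : 2 * (2 / (α + 2) - 1) + 1 = 2 / (α + 2) * (1 - α / 2) := by
    field_simp
    ring
  have hsq : Real.sqrt (2 * m / α) = 2 * Real.sqrt (m / (2 * α)) := by
    rw [show 2 * m / α = 2 ^ 2 * (m / (2 * α)) by field_simp, Real.sqrt_mul (by norm_num),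
      Real.sqrt_sq (by norm_num)]
  have hss : m / α = 2 * (Real.sqrt (m / (2 * α)) * Real.sqrt (m / (2 * α))) := by
    rw [Real.mul_self_sqrt (by positivity)]
    field_simp
  have hβ : 1 - α / 2 ≠ 0 := by linarith
  rw [hexp, Real.rpow_mul (by positivity), halfAction, radius, hsq, hss, mu]
  set P := ((α + 2) * Real.sqrt (m / (2 * α)) * T) ^ (2 / (α + 2))
  field_simp

theorem kineticIntegral_xbar {m α T φm φp : ℝ} (hm : 0 < m) (hα : 0 < α) (hα₂ : α < 2)
    (hT : 0 < T) :
    kineticIntegral (-T) T (xbar m α φm φp) = ENNReal.ofReal (halfAction m α T 1) := by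
  have hμ := mu_pos hm hα
  have hq := neg_one_lt_two_mul_exponent hα hα₂
  rw [← two_mul_rpow_eq_halfAction hm hα hα₂ hT,
    ← (lintegral_rpow_abs (by positivity) hμ hq hT.le).2, kineticIntegral]
  refine lintegral_congr_ae (ae_restrict_of_ae ?_)
  filter_upwards [compl_mem_ae_iff.2 (measure_singleton (0 : ℝ))] with t ht
  have h0 : 0 < |t| := abs_pos.2 ht
  rw [two_inv_mul_enorm_sq, norm_deriv_xbar hm hα ht, mul_pow, ← Real.rpow_two ((_ : ℝ) ^ _),
    ← Real.rpow_mul (by positivity), mul_comm (2 / (α + 2) - 1)]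
  congr 1
  rw [mul_div_right_comm]
  congr 1
  rw [mu, mul_pow, mul_pow, Real.sq_sqrt (by positivity)]
  field_simp

theorem potentialIntegral_xbar {m α T φm φp : ℝ} (hm : 0 < m) (hα : 0 < α) (hα₂ : α < 2)
    (hT : 0 < T) :
    potentialIntegral m α (-T) T (xbar m α φm φp) = ENNReal.ofReal (halfAction m α T 1) := by
  have hμ := mu_pos hm hα
  have hq := neg_one_lt_two_mul_exponent hα hα₂
  rw [← two_mul_rpow_eq_halfAction hm hα hα₂ hT,
    ← (lintegral_rpow_abs (by positivity) hμ hq hT.le).2, potentialIntegral]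
  refine lintegral_congr_ae (ae_restrict_of_ae ?_)
  filter_upwards [compl_mem_ae_iff.2 (measure_singleton (0 : ℝ))] with t ht
  have h0 : 0 < |t| := abs_pos.2 ht
  have hn : 0 < ‖xbar m α φm φp t‖ := by
    rw [norm_xbar hm hα]
    exact radius_pos hm hα h0
  rw [potential_of_ne_zero hα (norm_pos_iff.1 hn), norm_xbar hm hα, radius,
    ← Real.rpow_mul (by positivity), ← div_div, div_eq_mul_inv (m / α),
    ← Real.rpow_neg (by positivity)]
  congr 3
  field_simp
  ring

end Kepler

/-! ### The collision-ejection solution lies in the weak closure. -/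

namespace Kepler

/-- Continuity and differentiability off a countable set suffice for the fundamental theorem of
calculus, so f is the primitive of its integrable derivative. -/
theorem absolutelyContinuousOnInterval_of_deriv_off_countable {f : ℝ → ℂ} {a b : ℝ} {s : Set ℝ}
    (hs : s.Countable) (hc : Continuous f) (hd : ∀ t ∉ s, DifferentiableAt ℝ f t)
    (hi : IntervalIntegrable (deriv f) volume a b) : AbsolutelyContinuousOnInterval f a b := by
  have h := (hi.absolutelyContinuousOnInterval_complex left_mem_uIcc).lipschitzWith_comp
    (φ := fun z => f a + z) (LipschitzWith.of_dist_le_mul (K := 1) (by simp))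
  refine h.congr' fun t ht => ?_
  rw [integral_eq_of_hasDerivAt_off_countable f (deriv f) hs hc.continuousOn
    (fun r hr => (hd r hr.2).hasDerivAt)
    (hi.mono_set (uIcc_subset_uIcc left_mem_uIcc ht))]
  ring

theorem memLp_mul_rpow_abs {C μ q T : ℝ} (hμ : 0 < μ) (hq : -1 < 2 * q) (hT : 0 ≤ T) :
    MemLp (fun t => C * (μ * |t|) ^ q) 2 (volume.restrict (Icc (-T) T)) := by
  have hmeas : Measurable fun t : ℝ => C * (μ * |t|) ^ q :=
    ((measurable_id.abs.const_mul μ).pow_const q).const_mul C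
  rw [memLp_two_iff_integrable_sq hmeas.aestronglyMeasurable]
  have h := (lintegral_rpow_abs (sq_nonneg C) hμ hq hT).1
  refine h.congr (Eventually.of_forall fun t => ?_)
  simp only
  rw [mul_pow, ← Real.rpow_two ((μ * |t|) ^ q), ← Real.rpow_mul (by positivity), mul_comm q]

theorem memH1_of_norm_deriv_le {f : ℝ → ℂ} {C μ q T : ℝ} {s : Set ℝ} (hμ : 0 < μ)
    (hq : -1 < 2 * q) (hT : 0 ≤ T) (hs : s.Countable) (hc : Continuous f)
    (hd : ∀ t ∉ s, DifferentiableAt ℝ f t)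
    (hb : ∀ t ∉ s, ‖deriv f t‖ ≤ C * (μ * |t|) ^ q) : MemH1 (-T) T f := by
  have hL : MemLp (deriv f) 2 (volume.restrict (Icc (-T) T)) := by
    refine (memLp_mul_rpow_abs (C := C) hμ hq hT).mono (measurable_deriv f).aestronglyMeasurable ?_
    refine ae_restrict_of_ae ?_
    filter_upwards [compl_mem_ae_iff.2 (hs.measure_zero volume)] with t ht
    exact (hb t ht).trans (le_abs_self _)
  refine ⟨absolutelyContinuousOnInterval_of_deriv_off_countable hs hc hd ?_, hL⟩
  rw [intervalIntegrable_iff_integrableOn_Icc_of_le (by linarith)]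
  exact hL.integrable (by norm_num)

/-- The collision-ejection solution with the collision replaced by an arc of a circle, run through
in the time interval `[-δ, δ]`. -/
def roundedXbar (m α φm φp δ t : ℝ) : ℂ :=
  (radius m α (max |t| δ) : ℂ) *
    Complex.exp ((((φp + φm) / 2 + (φp - φm) / 2 * max (-1) (min 1 (t / δ)) : ℝ) : ℂ) * Complex.I)

variable {m α φm φp δ t : ℝ}

theorem norm_roundedXbar (hm : 0 < m) (hα : 0 < α) (hδ : 0 < δ) :
    ‖roundedXbar m α φm φp δ t‖ = radius m α (max |t| δ) := by
  rw [roundedXbar, norm_mul, Complex.norm_exp_ofReal_mul_I, mul_one, Complex.norm_real,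
    Real.norm_eq_abs, abs_of_pos (radius_pos hm hα (hδ.trans_le (le_max_right _ _)))]

theorem continuous_roundedXbar (hα : 0 < α) : Continuous (roundedXbar m α φm φp δ) := by
  have h : Continuous fun t : ℝ => radius m α (max |t| δ) :=
    (continuous_radius hα).comp (by fun_prop)
  unfold roundedXbar
  fun_prop

theorem roundedXbar_eq_xbar (hδ : 0 < δ) (ht : δ ≤ |t|) :
    roundedXbar m α φm φp δ t = xbar m α φm φp t := by
  rw [roundedXbar, xbar_eq, max_eq_left ht]
  congr 4
  rcases le_abs'.1 ht with h | h
  · have h1 : t / δ ≤ -1 := by rw [div_le_iff₀ hδ]; linarith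
    rw [min_eq_right (by linarith), max_eq_left h1, if_neg (by linarith)]
    ring
  · have h1 : 1 ≤ t / δ := by rw [le_div_iff₀ hδ]; linarith
    rw [min_eq_left h1, max_eq_right (by norm_num), if_pos (by linarith)]
    ring

theorem roundedXbar_eventuallyEq_xbar (hδ : 0 < δ) (ht : δ < |t|) :
    roundedXbar m α φm φp δ =ᶠ[𝓝 t] xbar m α φm φp := by
  filter_upwards [continuous_abs.continuousAt.eventually (lt_mem_nhds ht)] with s hs
  exact roundedXbar_eq_xbar hδ hs.le

theorem hasDerivAt_roundedXbar_of_abs_lt (hδ : 0 < δ) (ht : |t| < δ) :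
    HasDerivAt (roundedXbar m α φm φp δ) ((radius m α δ : ℂ) *
      (Complex.exp ((((φp + φm) / 2 + (φp - φm) / 2 * (t / δ) : ℝ) : ℂ) * Complex.I) *
        ((((φp - φm) / 2 * (1 / δ) : ℝ) : ℂ) * Complex.I))) t := by
  have h1 : HasDerivAt (fun s => (φp + φm) / 2 + (φp - φm) / 2 * (s / δ))
      ((φp - φm) / 2 * (1 / δ)) t :=
    (((hasDerivAt_id t).div_const δ).const_mul _).const_add _
  have h2 := ((h1.ofReal_comp.mul_const Complex.I).cexp).const_mul (radius m α δ : ℂ)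
  refine h2.congr_of_eventuallyEq ?_
  filter_upwards [continuous_abs.continuousAt.eventually (gt_mem_nhds ht)] with s hs
  rw [abs_lt] at hs
  have h3 : -1 ≤ s / δ := by rw [le_div_iff₀ hδ]; linarith
  have h4 : s / δ ≤ 1 := by rw [div_le_iff₀ hδ]; linarith
  rw [roundedXbar, max_eq_right (abs_lt.2 hs).le, min_eq_right h4, max_eq_right h3]

/-- The majorant does not depend on δ. On the arc the speed is constant, proportional to μ (μδ)^q
with q = 2/(α+2) - 1 < 0, and (μδ)^q ≤ (μ|t|)^q for |t| < δ. -/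
theorem roundedXbar_deriv_bound (hm : 0 < m) (hα : 0 < α) (hδ : 0 < δ) (ht0 : t ≠ 0)
    (htδ : |t| ≠ δ) :
    DifferentiableAt ℝ (roundedXbar m α φm φp δ) t ∧
      ‖deriv (roundedXbar m α φm φp δ) t‖ ≤ mu m α * (2 / (α + 2) + |φp - φm| / 2) *
        (mu m α * |t|) ^ (2 / (α + 2) - 1) := by
  have hμ := mu_pos hm hα
  have h0 : 0 < |t| := abs_pos.2 ht0
  have hp : 0 < (mu m α * |t|) ^ (2 / (α + 2) - 1) := by positivity
  rcases lt_or_gt_of_ne htδ with h | h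
  · have hd := hasDerivAt_roundedXbar_of_abs_lt (m := m) (α := α) (φm := φm) (φp := φp) hδ h
    refine ⟨hd.differentiableAt, ?_⟩
    rw [hd.deriv, norm_mul, norm_mul, norm_mul, Complex.norm_exp_ofReal_mul_I, Complex.norm_I,
      Complex.norm_real, Complex.norm_real, Real.norm_eq_abs, Real.norm_eq_abs,
      abs_of_pos (radius_pos hm hα hδ), abs_mul, abs_div, abs_of_pos (one_div_pos.2 hδ),
      abs_of_pos (two_pos : (0 : ℝ) < 2)]
    have h1 : radius m α δ = mu m α * δ * (mu m α * δ) ^ (2 / (α + 2) - 1) := by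
      rw [radius, Real.rpow_sub_one (by positivity)]
      field_simp
    have h2 : (mu m α * δ) ^ (2 / (α + 2) - 1) ≤ (mu m α * |t|) ^ (2 / (α + 2) - 1) := by
      refine Real.rpow_le_rpow_of_nonpos (by positivity) (by gcongr) ?_
      rw [sub_nonpos, div_le_one (by linarith)]
      linarith
    calc _ = mu m α * (|φp - φm| / 2) * (mu m α * δ) ^ (2 / (α + 2) - 1) := by
          rw [h1]; field_simp
      _ ≤ mu m α * (|φp - φm| / 2) * (mu m α * |t|) ^ (2 / (α + 2) - 1) := by gcongr
      _ ≤ _ := by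
          gcongr
          have : 0 < 2 / (α + 2) := by positivity
          linarith
  · have he := roundedXbar_eventuallyEq_xbar (m := m) (α := α) (φm := φm) (φp := φp) hδ h
    refine ⟨(hasDerivAt_xbar hm hα ht0).differentiableAt.congr_of_eventuallyEq he, ?_⟩
    rw [he.deriv_eq, norm_deriv_xbar hm hα ht0]
    gcongr
    linarith [abs_nonneg (φp - φm)]

theorem roundedXbar_mem_GammaStar {T : ℝ} (hm : 0 < m) (hα : 0 < α) (hα₂ : α < 2) (hδ : 0 < δ)
    (hδT : δ ≤ T) : roundedXbar m α φm φp δ ∈ GammaStar m α φm φp T T := by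
  have hT := hδ.trans_le hδT
  have habs : δ ≤ |T| := hδT.trans (le_abs_self T)
  refine ⟨memH1_of_norm_deriv_le (s := {0, δ, -δ}) (mu_pos hm hα)
    (neg_one_lt_two_mul_exponent hα hα₂) hT.le (Set.toFinite _).countable
    (continuous_roundedXbar hα)
    (fun t ht => (roundedXbar_deriv_bound (φm := φm) (φp := φp) hm hα hδ ?_ ?_).1)
    (fun t ht => (roundedXbar_deriv_bound hm hα hδ ?_ ?_).2),
    fun t _ => ?_, roundedXbar_eq_xbar hδ (by rwa [abs_neg]), roundedXbar_eq_xbar hδ habs,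
    fun t => (φp + φm) / 2 + (φp - φm) / 2 * max (-1) (min 1 (t / δ)), by fun_prop,
    fun t _ => ?_, ?_, ?_⟩
  iterate 2
    · exact fun h => ht (by simp [h])
    · intro h
      rcases (abs_eq hδ.le).1 h with h | h <;> exact ht (by simp [h])
  · rw [← norm_pos_iff, norm_roundedXbar hm hα hδ]
    exact radius_pos hm hα (hδ.trans_le (le_max_right _ _))
  · rw [norm_roundedXbar hm hα hδ]
    rfl
  · have h1 : -T / δ ≤ -1 := by rw [div_le_iff₀ hδ]; linarith
    simp only
    rw [min_eq_right (by linarith), max_eq_left h1]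
    ring
  · have h1 : 1 ≤ T / δ := by rw [le_div_iff₀ hδ]; linarith
    simp only
    rw [min_eq_left h1, max_eq_right (by norm_num)]
    ring

/-- The collision-ejection solution is a weak limit of collision-free curves. -/
theorem xbar_mem_Gamma {T : ℝ} (hm : 0 < m) (hα : 0 < α) (hα₂ : α < 2) (hT : 0 < T) :
    xbar m α φm φp ∈ Gamma m α φm φp T T := by
  have hμ := mu_pos hm hα
  have hq := neg_one_lt_two_mul_exponent hα hα₂
  refine ⟨memH1_of_norm_deriv_le (s := {0}) hμ hq hT.le (Set.toFinite _).countable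
    (continuous_xbar hm hα) (fun t ht => (hasDerivAt_xbar hm hα ht).differentiableAt)
    (fun t ht => (norm_deriv_xbar hm hα ht).le), fun n => roundedXbar m α φm φp (T / (n + 1)),
    fun n => roundedXbar_mem_GammaStar hm hα hα₂ (by positivity)
      (div_le_self hT.le (by linarith [n.cast_nonneg (α := ℝ)])), fun g₀ g₁ hg₀ hg₁ => ?_⟩
  set C := mu m α * (2 / (α + 2) + |φp - φm| / 2)
  have hδ : ∀ n : ℕ, 0 < T / (n + 1) := fun n => by positivity
  have hδT : ∀ n : ℕ, T / (n + 1) ≤ T := fun n =>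
    div_le_self hT.le (by linarith [n.cast_nonneg (α := ℝ)])
  refine tendsto_integral_of_dominated_convergence
    (fun t => ‖g₀ t‖ * radius m α T + ‖g₁ t‖ * (C * (mu m α * |t|) ^ (2 / (α + 2) - 1)))
    (fun n => ?_) ?_ (fun n => ?_) ?_
  · exact (hg₀.1.inner (continuous_roundedXbar hα).aestronglyMeasurable).add
      (hg₁.1.inner (measurable_deriv _).aestronglyMeasurable)
  · exact ((hg₀.integrable (by norm_num)).norm.mul_const _).add
      (MemLp.integrable_mul hg₁.norm (memLp_mul_rpow_abs hμ hq hT.le))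
  · rw [ae_restrict_iff' measurableSet_Icc]
    have hs : ({0, T / (n + 1), -(T / (n + 1))} : Set ℝ).Countable := (Set.toFinite _).countable
    filter_upwards [compl_mem_ae_iff.2 (hs.measure_zero volume)] with t ht hmem
    refine (norm_add_le _ _).trans (add_le_add ?_ ?_)
    · refine (norm_inner_le_norm _ _).trans ?_
      rw [norm_roundedXbar hm hα (hδ n)]
      refine mul_le_mul_of_nonneg_left ?_ (norm_nonneg _)
      exact Real.rpow_le_rpow (mul_nonneg hμ.le (le_max_of_le_left (abs_nonneg t)))
        (mul_le_mul_of_nonneg_left (max_le (abs_le.2 hmem) (hδT n)) hμ.le) (by positivity)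
    · refine (norm_inner_le_norm _ _).trans (mul_le_mul_of_nonneg_left ?_ (norm_nonneg _))
      refine (roundedXbar_deriv_bound hm hα (hδ n) ?_ ?_).2
      · exact fun h => ht (by simp [h])
      · intro h
        rcases (abs_eq (hδ n).le).1 h with h | h <;> exact ht (by simp [h])
  · refine ae_restrict_of_ae ?_
    filter_upwards [compl_mem_ae_iff.2 (measure_singleton (0 : ℝ))] with t ht
    have h0 : 0 < |t| := abs_pos.2 ht
    have hlim : Tendsto (fun n : ℕ => T / ((n : ℝ) + 1)) atTop (𝓝 0) :=
      (tendsto_const_div_atTop_nhds_zero_nat T).comp (tendsto_add_atTop_nat 1) |>.congr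
        fun n => by simp
    -- For fixed t ≠ 0 the rounded curve coincides with x̄ near t as soon as T/(n+1) < |t|, so the
    -- integrand is eventually constant in n.
    refine tendsto_const_nhds.congr' ?_
    filter_upwards [hlim.eventually (gt_mem_nhds h0)] with n hn
    rw [roundedXbar_eq_xbar (hδ n) hn.le, (roundedXbar_eventuallyEq_xbar (hδ n) hn).deriv_eq]

end Kepler

/-! ### The infima, and the dichotomy on the flat angle. -/

namespace Kepler

variable {m α T φm φp : ℝ}

theorem maupertuisInf_eq (hm : 0 < m) (hα : 0 < α) (hα₂ : α < 2) (hT : 0 < T) {y : ℝ → ℂ}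
    (hy : y ∈ Gamma m α φm φp T T) (h : maupertuis m α T y = ENNReal.ofReal
      (halfAction m α T |Real.sin ((1 - α / 2) * (φp - φm) / 2)| ^ 2)) :
    maupertuisInf m α φm φp T = maupertuis m α T y :=
  le_antisymm (iInf₂_le y hy)
    (le_iInf₂ fun _ hx => h ▸ halfAction_sq_le_maupertuis hm hα hα₂ hT hT hx)

theorem freeTimeActionInf_eq (hm : 0 < m) (hα : 0 < α) (hα₂ : α < 2) (hT : 0 < T) {S : ℝ}
    (hS : 0 < S) {η : ℝ → ℂ} (hη : η ∈ Gamma m α φm φp T S) (h : action m α S η = ENNReal.ofReal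
      (2 * halfAction m α T |Real.sin ((1 - α / 2) * (φp - φm) / 2)|)) :
    freeTimeActionInf m α φm φp T = action m α S η :=
  le_antisymm (iInf₂_le_of_le S hS (iInf₂_le η hη))
    (le_iInf₂ fun _ hS' => le_iInf₂ fun _ hx =>
      h ▸ two_mul_halfAction_le_action hm hα hα₂ hT hS' hx)

theorem maupertuis_xbar (hm : 0 < m) (hα : 0 < α) (hα₂ : α < 2) (hT : 0 < T) :
    maupertuis m α T (xbar m α φm φp) = ENNReal.ofReal (halfAction m α T 1 ^ 2) := by
  rw [maupertuis, kineticIntegral_xbar hm hα hα₂ hT, potentialIntegral_xbar hm hα hα₂ hT,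
    ← ENNReal.ofReal_mul (halfAction_nonneg hm hα hα₂ hT zero_le_one), sq]

theorem action_xbar (hm : 0 < m) (hα : 0 < α) (hα₂ : α < 2) (hT : 0 < T) :
    action m α T (xbar m α φm φp) = ENNReal.ofReal (2 * halfAction m α T 1) := by
  have h := halfAction_nonneg hm hα hα₂ hT zero_le_one
  rw [action_eq_add, kineticIntegral_xbar hm hα hα₂ hT, potentialIntegral_xbar hm hα hα₂ hT,
    ← ENNReal.ofReal_add h h, two_mul]

/-- As 1 ≤ α gives β ≤ 1/2, the half-angle γ is at most π/2 in modulus. In the equality case the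
flat chord is a diameter through the collision. -/
theorem flat_angle_lt_or_eq (hα₁ : 1 ≤ α) (hα₂ : α < 2) (hφ₁ : |φp - φm| ≤ 2 * Real.pi) :
    |(1 - α / 2) * (φp - φm) / 2| < Real.pi / 2 ∨
      (α = 1 ∧ |φp - φm| = 2 * Real.pi ∧
        |Real.sin ((1 - α / 2) * (φp - φm) / 2)| = 1) := by
  have hpi := Real.pi_pos
  have habs : |(1 - α / 2) * (φp - φm) / 2| = (1 - α / 2) * |φp - φm| / 2 := by
    rw [abs_div, abs_mul, abs_of_pos (by linarith : 0 < 1 - α / 2), abs_two]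
  by_cases hα : α = 1
  · rcases hφ₁.lt_or_eq with h | h
    · left
      rw [habs, hα]
      linarith
    · refine Or.inr ⟨hα, h, ?_⟩
      rw [Real.abs_sin_eq_sin_abs_of_abs_le_pi (by rw [habs, h, hα]; linarith), habs, h, hα,
        show (1 - 1 / 2) * (2 * Real.pi) / 2 = Real.pi / 2 by ring, Real.sin_pi_div_two]
  · left
    have h1 : 1 < α := lt_of_le_of_ne hα₁ (Ne.symm hα)
    rw [habs]
    nlinarith [abs_nonneg (φp - φm)]

end Kepler
end

theorem mainTheorem5 (m α T φm φp : ℝ) (hm : 0 < m) (hα₁ : 1 ≤ α) (hα₂ : α < 2) (hT : 0 < T)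
    (hφ₀ : 0 < |φp - φm|) (hφ₁ : |φp - φm| ≤ 2 * Real.pi) :
    (∃ y ∈ Kepler.Gamma m α φm φp T T,
      Kepler.maupertuis m α T y = Kepler.maupertuisInf m α φm φp T ∧
      0 < Kepler.maupertuisInf m α φm φp T ∧
      Kepler.maupertuisInf m α φm φp T < ⊤ ∧
      (1 < α ∨ (α = 1 ∧ |φp - φm| < 2 * Real.pi) →
        y ∈ Kepler.GammaStar m α φm φp T T ∧
        (∃ ω : ℝ, 0 < ω ∧
          ENNReal.ofReal (ω ^ 2) =
            Kepler.potentialIntegral m α (-T) T y / Kepler.kineticIntegral (-T) T y ∧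
          Kepler.IsZeroEnergySolution m α (-T / ω) (T / ω) (fun t => y (ω * t))) ∧
        Kepler.maupertuis m α T y < Kepler.maupertuis m α T (Kepler.xbar m α φm φp))) ∧
    (∃ S : ℝ, 0 < S ∧ ∃ η ∈ Kepler.Gamma m α φm φp T S,
      Kepler.action m α S η = Kepler.freeTimeActionInf m α φm φp T ∧
      Kepler.freeTimeActionInf m α φm φp T < ⊤ ∧
      (1 < α ∨ (α = 1 ∧ |φp - φm| < 2 * Real.pi) →
        η ∈ Kepler.GammaStar m α φm φp T S ∧
        Kepler.IsZeroEnergySolution m α (-S) S η ∧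
        Kepler.action m α S η < Kepler.action m α T (Kepler.xbar m α φm φp))) := by
  have hα : 0 < α := by linarith
  rcases Kepler.flat_angle_lt_or_eq hα₁ hα₂ hφ₁ with hγ | ⟨h1, h2, h3⟩
  · have hβ : 0 < 1 - α / 2 := by linarith
    have hγ₀ : (1 - α / 2) * (φp - φm) / 2 ≠ 0 :=
      div_ne_zero (mul_ne_zero hβ.ne' (abs_pos.1 hφ₀)) two_ne_zero
    obtain ⟨S, hS, x, hsol, hx⟩ := Kepler.exists_zeroEnergy_minimizer hm hα hα₂ hT hγ hγ₀
    have hcos : 0 < Real.cos ((1 - α / 2) * (φp - φm) / 2) :=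
      Real.cos_pos_of_mem_Ioo (abs_lt.1 hγ)
    have hs1 : |Real.sin ((1 - α / 2) * (φp - φm) / 2)| < 1 := by
      rw [← sq_lt_one_iff_abs_lt_one]
      nlinarith [Real.sin_sq_add_cos_sq ((1 - α / 2) * (φp - φm) / 2)]
    have hs0 : 0 < |Real.sin ((1 - α / 2) * (φp - φm) / 2)| := by
      have := Real.pi_pos
      refine abs_pos.2 fun h => hγ₀ ?_
      exact (Real.sin_eq_zero_iff_of_lt_of_lt (by linarith [(abs_lt.1 hγ).1])
        (by linarith [(abs_lt.1 hγ).2])).1 h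
    have hB1 := Kepler.halfAction_lt hm hα hα₂ hT hs1
    have hB0 : 0 < Kepler.halfAction m α T |Real.sin ((1 - α / 2) * (φp - φm) / 2)| :=
      (Kepler.halfAction_nonneg hm hα hα₂ hT le_rfl).trans_lt
        (Kepler.halfAction_lt hm hα hα₂ hT hs0)
    set B := Kepler.halfAction m α T |Real.sin ((1 - α / 2) * (φp - φm) / 2)|
    constructor
    -- The time change c = S/T brings the minimizer to [-T, T]; the required ω is its inverse T/S,
    -- since the integrals are c B and B/c.
    · have hST : 0 < S / T := by positivity
      obtain ⟨hy, hK, hP⟩ := hx (S / T) hST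
      rw [div_div_cancel₀ hS.ne'] at hy hK hP
      have hM : Kepler.maupertuis m α T (fun t => x (S / T * t)) =
          ENNReal.ofReal (B ^ 2) := by
        rw [Kepler.maupertuis, hK, hP, ← ENNReal.ofReal_mul (by positivity)]
        congr 1
        field_simp
      have hinf := Kepler.maupertuisInf_eq hm hα hα₂ hT (Kepler.GammaStar_subset_Gamma hy) hM
      refine ⟨_, Kepler.GammaStar_subset_Gamma hy, hinf.symm, ?_, ?_, fun _ => ⟨hy, ⟨T / S,
        by positivity, ?_, ?_⟩, ?_⟩⟩
      · rw [hinf, hM]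
        exact ENNReal.ofReal_pos.2 (by positivity)
      · rw [hinf, hM]
        exact ENNReal.ofReal_lt_top
      · rw [hK, hP, ← ENNReal.ofReal_div_of_pos (by positivity)]
        congr 1
        field_simp
      · have e1 : (fun t => x (S / T * (T / S * t))) = x := by
          funext t
          congr 1
          field_simp
        have e2 : -T / (T / S) = -S := by field_simp
        have e3 : T / (T / S) = S := by field_simp
        rw [e2, e3]
        exact e1.symm ▸ hsol
      · rw [hM, Kepler.maupertuis_xbar hm hα hα₂ hT,
          ENNReal.ofReal_lt_ofReal_iff (pow_pos (hB0.trans hB1) 2)]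
        exact pow_lt_pow_left₀ hB1 hB0.le two_ne_zero
    · obtain ⟨hy, hK, hP⟩ := hx 1 one_pos
      simp only [div_one, one_mul] at hy hK hP
      have hA : Kepler.action m α S x = ENNReal.ofReal (2 * B) := by
        rw [Kepler.action_eq_add, hK, hP, ← ENNReal.ofReal_add hB0.le hB0.le, two_mul]
      have hinf := Kepler.freeTimeActionInf_eq hm hα hα₂ hT hS
        (Kepler.GammaStar_subset_Gamma hy) hA
      refine ⟨S, hS, x, Kepler.GammaStar_subset_Gamma hy, hinf.symm, ?_, fun _ => ⟨hy, hsol, ?_⟩⟩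
      · rw [hinf, hA]
        exact ENNReal.ofReal_lt_top
      · rw [hA, Kepler.action_xbar hm hα hα₂ hT,
          ENNReal.ofReal_lt_ofReal_iff (by linarith)]
        linarith
  -- Here |sin γ| = 1, so x̄ attains both lower bounds, and the conditional claims are vacuous.
  · have hΓ := Kepler.xbar_mem_Gamma (φm := φm) (φp := φp) hm hα hα₂ hT
    have hB0 : 0 < Kepler.halfAction m α T 1 :=
      (Kepler.halfAction_nonneg hm hα hα₂ hT le_rfl).trans_lt
        (Kepler.halfAction_lt hm hα hα₂ hT one_pos)
    have hno : ¬ (1 < α ∨ (α = 1 ∧ |φp - φm| < 2 * Real.pi)) := by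
      rintro (h | h)
      · exact h.ne' h1
      · exact h.2.ne h2
    have hM := Kepler.maupertuis_xbar (φm := φm) (φp := φp) hm hα hα₂ hT
    have hA := Kepler.action_xbar (φm := φm) (φp := φp) hm hα hα₂ hT
    have hinfM := Kepler.maupertuisInf_eq hm hα hα₂ hT hΓ (by rw [h3]; exact hM)
    have hinfA := Kepler.freeTimeActionInf_eq hm hα hα₂ hT hT hΓ (by rw [h3]; exact hA)
    refine ⟨⟨_, hΓ, hinfM.symm, ?_, ?_, fun h => absurd h hno⟩,
      ⟨T, hT, _, hΓ, hinfA.symm, ?_, fun h => absurd h hno⟩⟩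
    · rw [hinfM, hM]
      exact ENNReal.ofReal_pos.2 (by positivity)
    · rw [hinfM, hM]
      exact ENNReal.ofReal_lt_top
    · rw [hinfA, hA]
      exact ENNReal.ofReal_lt_top
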